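/- **Setting.** Write $\mathcal H_2$ for the Hilbert space of complex matrix-valued transfer functions $G(z)=\sum_{i\ge 0}z^{-i}G_i$ with $\sum_i\mathrm{Tr}(G_iG_i^*)<\infty$ (sizes understood), with $\langle G,H\rangle=\sum_i \mathrm{Tr}(G_iH_i^*)$ and norm $\|\cdot\|$; $\mathbf P_{\mathcal M}$ is the orthogonal projection onto a closed subspace $\mathcal M$, and $\mathcal R_p$ is the space of proper real rational transfer matrices. Let real matrices $A,B_1,B_2,C_1,C_2,D_{12},D_{21}$ of compatible sizes be given, where all eigenvalues of $A$ lie in the open unit disc and $D_{12}^TD_{12}$ and $D_{21}D_{21}^T$ are positive definite. Put $$P_{11}=C_1(zI-A)^{-1}B_1,\quad P_{12}=C_1(zI-A)^{-1}B_2+D_{12},\quad P_{21}=C_2(zI-A)^{-1}B_1+D_{21}.$$ Let $X=X^T$ be a stabilizing solution of the control Riccati equation $$X=C_1^TC_1+A^TXA-(A^TXB_2+C_1^TD_{12})\Omega^{-1}(B_2^TXA+D_{12}^TC_1),\qquad \Omega=D_{12}^TD_{12}+B_2^TXB_2,$$ that is, $\Omega$ is invertible and with $K=-\Omega^{-1}(B_2^TXA+D_{12}^TC_1)$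 all eigenvalues of $A+B_2K$ lie in the open unit disc. Let $Y=Y^T$ be a stabilizing solution of the estimation Riccati equation $$Y=B_1B_1^T+AYA^T-(AYC_2^T+B_1D_{21}^T)\Psi^{-1}(C_2YA^T+D_{21}B_1^T),\qquad \Psi=D_{21}D_{21}^T+C_2YC_2^T,$$ that is, $\Psi$ is invertible and with $L=-(AYC_2^T+B_1D_{21}^T)\Psi^{-1}$ all eigenvalues of $A+LC_2$ lie in the open unit disc. Define $$W_L=\bigl(I+K(zI-A-B_2K)^{-1}B_2\bigr)\Omega^{-1/2},\quad W_R=\Psi^{-1/2}\bigl(I+C_2(zI-A-LC_2)^{-1}L\bigr),\quad T=\Omega^{1/2}K(zI-A)^{-1}L\Psi^{1/2}.$$ Let $N\ge1$, let $p_2$ be the number of columns of $B_2$ and $q_2$ the number of rows of $C_2$, let $\mathcal X=\bigoplus_{i=1}^N z^{-i}\mathbb C^{p_2\times q_2}$, let $\mathcal Y$ be a real linear subspace of $\bigoplus_{i=1}^N z^{-i}\mathbb R^{p_2\times q_2}$, and let $\mathcal S=\mathcal Y\oplus z^{-(N+1)}\mathcal R_p$. **Theorem.** For every $Q\in z^{-1}\mathcal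 H_2$ one has $P_{11}+P_{12}QP_{21}\in\mathcal H_2$; moreover $T\in\mathcal H_2$, and for every $V\in\mathcal Y$ one has $W_L^{-1}VW_R^{-1}\in\mathcal H_2$ and $\langle \mathbf P_{\mathcal X}(W_L^{-1}VW_R^{-1}),T\rangle$ is real. 1. The transfer matrix $Q_N=-W_L\,\mathbf P_{z^{-(N+1)}\mathcal H_2}(T)\,W_R$ is the unique minimizer of $\|P_{11}+P_{12}QP_{21}\|$ over $Q\in z^{-(N+1)}\mathcal H_2$. 2. The function $$V\mapsto\bigl\|\mathbf P_{\mathcal X}(W_L^{-1}VW_R^{-1})\bigr\|^2+2\bigl\langle \mathbf P_{\mathcal X}(W_L^{-1}VW_R^{-1}),T\bigr\rangle$$ has a unique minimizer $V^*$ over $\mathcal Y$. Put $U^*=Q_N-W_L\,\mathbf P_{z^{-(N+1)}\mathcal H_2}(W_L^{-1}V^*W_R^{-1})\,W_R$. Then $Q^*=U^*+V^*$ lies in $\mathcal S\cap z^{-1}\mathcal H_2$ and is the unique minimizer of $\|P_{11}+P_{12}QP_{21}\|$ over $Q\in\mathcal S\cap z^{-1}\mathcal H_2$. -/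

import Mathlib

open scoped PowerSeries

noncomputable section

namespace ModelMatching

/-- Transfer matrices with `p` rows and `q` columns, represented by their expansion
`G(z) = ∑ i, z⁻ⁱ Gᵢ` at `z = ∞`: a matrix of power series in the variable `PowerSeries.X = z⁻¹`.
Sums and products of transfer matrices are sums and products of these matrices. -/
abbrev TransferMatrix (p q : ℕ) := Matrix (Fin p) (Fin q) ℂ⟦X⟧

namespace TransferMatrix

variable {n p q : ℕ}

/-- The `i`-th coefficient `Gᵢ` of `G(z) = ∑ i, z⁻ⁱ Gᵢ`. -/
def coef (G : TransferMatrix p q) (i : ℕ) : Matrix (Fin p) (Fin q) ℂ :=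
  G.map (fun g => PowerSeries.coeff i g)

/-- The constant transfer matrix with real value `M`. -/
def const (M : Matrix (Fin p) (Fin q) ℝ) : TransferMatrix p q :=
  M.map (fun x => PowerSeries.C (x : ℂ))

/-- The transfer matrix `D + C (zI - A)⁻¹ B = D + ∑ k, z^{-(k+1)} C Aᵏ B` of a real state-space
realization. -/
def realization (A : Matrix (Fin n) (Fin n) ℝ) (B : Matrix (Fin n) (Fin q) ℝ)
    (C : Matrix (Fin p) (Fin n) ℝ) (D : Matrix (Fin p) (Fin q) ℝ) : TransferMatrix p q :=
  Matrix.of fun i j => PowerSeries.mk fun k =>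
    match k with
    | 0 => ((D i j : ℝ) : ℂ)
    | k + 1 => (((C * A ^ k * B) i j : ℝ) : ℂ)

/-- The Hardy space `H₂`: `∑ i, Tr (Gᵢ Gᵢ*) < ∞`. -/
def InH2 (G : TransferMatrix p q) : Prop :=
  Summable fun i => (coef G i * (coef G i).conjTranspose).trace

/-- The inner product `⟨G, H⟩ = ∑ i, Tr (Gᵢ Hᵢ*)` of `H₂`. -/
def h2Inner (G H : TransferMatrix p q) : ℂ :=
  ∑' i, (coef G i * (coef H i).conjTranspose).trace

/-- The norm `‖G‖ = ⟨G, G⟩^{1/2}` of `H₂`. -/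
def h2Norm (G : TransferMatrix p q) : ℝ :=
  Real.sqrt (h2Inner G G).re

/-- The subspace `z⁻ᵏ H₂` of `H₂`. -/
def shiftH2 (k : ℕ) : Set (TransferMatrix p q) :=
  {G | InH2 G ∧ ∀ i < k, coef G i = 0}

/-- The space `𝒳 = ⨁_{i = 1}^N z⁻ⁱ ℂ^{p × q}` of strictly proper FIR transfer matrices. -/
def FIR (N : ℕ) : Set (TransferMatrix p q) :=
  {G | ∀ i, (i < 1 ∨ N < i) → coef G i = 0}

/-- The set `⨁_{i = 1}^N z⁻ⁱ ℝ^{p × q}` of those elements of `𝒳` that have real coefficients. -/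
def RealFIR (N : ℕ) : Set (TransferMatrix p q) :=
  {G | G ∈ FIR N ∧ ∀ i a b, (coef G i a b).im = 0}

/-- The orthogonal projection of `H₂` onto `z⁻ᵏ H₂`, which drops the coefficients of index
less than `k`. -/
def projShift (k : ℕ) (G : TransferMatrix p q) : TransferMatrix p q :=
  G.map fun g => PowerSeries.mk fun i => if k ≤ i then PowerSeries.coeff i g else 0

/-- The orthogonal projection of `H₂` onto `𝒳`, which keeps the coefficients of index
`1, …, N`. -/
def projFIR (N : ℕ) (G : TransferMatrix p q) : TransferMatrix p q :=
  G.map fun g => PowerSeries.mk fun i =>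
    if 1 ≤ i ∧ i ≤ N then PowerSeries.coeff i g else 0

/-- `R_p`: proper real rational transfer matrices. A scalar function is proper and real rational
in `z` exactly if it is `a(z⁻¹) / b(z⁻¹)` with real polynomials `a`, `b` and `b(0) ≠ 0`. -/
def IsProperRational (G : TransferMatrix p q) : Prop :=
  ∀ i j, ∃ a b : Polynomial ℝ, b.coeff 0 ≠ 0 ∧
    ((b.map Complex.ofRealHom : Polynomial ℂ) : ℂ⟦X⟧) * G i j =
      ((a.map Complex.ofRealHom : Polynomial ℂ) : ℂ⟦X⟧)

/-- The space `𝒮 = 𝒴 ⊕ z^{-(N+1)} R_p`. -/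
def constraintSpace (N : ℕ) (𝒴 : Submodule ℝ (TransferMatrix p q)) :
    Set (TransferMatrix p q) :=
  {Q | ∃ V ∈ 𝒴, ∃ R : TransferMatrix p q, IsProperRational R ∧
    Q = V + (PowerSeries.X ^ (N + 1) : ℂ⟦X⟧) • R}

/-! Checks of the definitions: the state-space formula, and the two projections. -/

theorem realization_eq (A : Matrix (Fin n) (Fin n) ℝ) (B : Matrix (Fin n) (Fin q) ℝ)
    (C : Matrix (Fin p) (Fin n) ℝ) (D : Matrix (Fin p) (Fin q) ℝ) :
    realization A B C D = const D + (PowerSeries.X : ℂ⟦X⟧) •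
      (const C * (1 - (PowerSeries.X : ℂ⟦X⟧) • const A)⁻¹ * const B) := by
  have hS : (1 - (PowerSeries.X : ℂ⟦X⟧) • const A) *
      (Matrix.of fun i j => PowerSeries.mk fun k => (((A ^ k) i j : ℝ) : ℂ)) = 1 := by
    rw [sub_mul, one_mul, Matrix.smul_mul]
    ext i j k
    cases k with
    | zero => by_cases h : i = j <;> simp [Matrix.one_apply, h]
    | succ k =>
      have h1 : PowerSeries.coeff (k + 1) ((1 : Matrix (Fin n) (Fin n) ℂ⟦X⟧) i j) = 0 := by
        by_cases h : i = j <;> simp [Matrix.one_apply, h, PowerSeries.coeff_one]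
      rw [h1]
      simp [Matrix.mul_apply, const, PowerSeries.coeff_succ_X_mul, pow_succ' A]
  rw [Matrix.inv_eq_right_inv hS]
  ext i j k
  cases k with
  | zero => simp [realization, const]
  | succ k =>
    simp [realization, const, PowerSeries.coeff_succ_X_mul, Matrix.mul_apply]

theorem coef_projShift (k : ℕ) (G : TransferMatrix p q) (i : ℕ) :
    coef (projShift k G) i = if k ≤ i then coef G i else 0 := by
  ext a b
  by_cases h : k ≤ i <;> simp [coef, projShift, h]

theorem coef_projFIR (N : ℕ) (G : TransferMatrix p q) (i : ℕ) :
    coef (projFIR N G) i = if 1 ≤ i ∧ i ≤ N then coef G i else 0 := by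
  ext a b
  by_cases h : 1 ≤ i ∧ i ≤ N <;> simp [coef, projFIR, h]

theorem coef_sub (G H : TransferMatrix p q) (i : ℕ) :
    coef (G - H) i = coef G i - coef H i := by
  ext a b
  simp [coef]

theorem projShift_isOrthogonalProjection (k : ℕ) (G : TransferMatrix p q) (hG : InH2 G) :
    projShift k G ∈ shiftH2 k ∧ ∀ H ∈ shiftH2 k, h2Inner (G - projShift k G) H = 0 := by
  refine ⟨⟨?_, fun i hi => by simp [coef_projShift, hi]⟩, fun H hH => ?_⟩
  · refine (hG.indicator {i | k ≤ i}).congr fun i => ?_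
    by_cases h : k ≤ i <;> simp [coef_projShift, h]
  · unfold h2Inner
    rw [← tsum_zero (α := ℂ) (β := ℕ)]
    congr 1
    ext i
    by_cases h : k ≤ i
    · simp [coef_sub, coef_projShift, h]
    · simp [hH.2 i (by omega)]

theorem projFIR_isOrthogonalProjection (N : ℕ) (G : TransferMatrix p q) :
    projFIR N G ∈ FIR N ∧ ∀ H ∈ FIR N, h2Inner (G - projFIR N G) H = 0 := by
  refine ⟨fun i hi => ?_, fun H hH => ?_⟩
  · rw [coef_projFIR, if_neg (by omega)]
  · unfold h2Inner
    rw [← tsum_zero (α := ℂ) (β := ℕ)]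
    congr 1
    ext i
    by_cases h : 1 ≤ i ∧ i ≤ N
    · simp [coef_sub, coef_projFIR, h]
    · simp [hH i (by omega)]

end TransferMatrix

open TransferMatrix

/-- All eigenvalues of the real square matrix `A` lie in the open unit disc. -/
def SchurStable {n : ℕ} (A : Matrix (Fin n) (Fin n) ℝ) : Prop :=
  ∀ μ ∈ spectrum ℂ (A.map Complex.ofReal), ‖μ‖ < 1

/-- The positive semidefinite square root of a real positive semidefinite matrix. -/
def matSqrt {n : ℕ} (M : Matrix (Fin n) (Fin n) ℝ) : Matrix (Fin n) (Fin n) ℝ :=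
  open scoped MatrixOrder in CFC.sqrt M

theorem matSqrt_spec {n : ℕ} {M : Matrix (Fin n) (Fin n) ℝ} (hM : M.PosSemidef) :
    (matSqrt M).PosSemidef ∧ matSqrt M * matSqrt M = M := by
  open scoped MatrixOrder in
  exact ⟨Matrix.nonneg_iff_posSemidef.mp (CFC.sqrt_nonneg M),
    CFC.sqrt_mul_sqrt_self M (Matrix.nonneg_iff_posSemidef.mpr hM)⟩

/-- State-space data of the plant `P`, with state dimension `n`, input dimensions `p₁`, `p₂` and
output dimensions `q₁`, `q₂`; the blocks `D₁₁` and `D₂₂` are zero. -/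
structure Plant (n p₁ p₂ q₁ q₂ : ℕ) where
  A : Matrix (Fin n) (Fin n) ℝ
  B₁ : Matrix (Fin n) (Fin p₁) ℝ
  B₂ : Matrix (Fin n) (Fin p₂) ℝ
  C₁ : Matrix (Fin q₁) (Fin n) ℝ
  C₂ : Matrix (Fin q₂) (Fin n) ℝ
  D₁₂ : Matrix (Fin q₁) (Fin p₂) ℝ
  D₂₁ : Matrix (Fin q₂) (Fin p₁) ℝ

namespace Plant

open Matrix

variable {n p₁ p₂ q₁ q₂ : ℕ} (P : Plant n p₁ p₂ q₁ q₂)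

def P₁₁ : TransferMatrix q₁ p₁ := realization P.A P.B₁ P.C₁ 0

def P₁₂ : TransferMatrix q₁ p₂ := realization P.A P.B₂ P.C₁ P.D₁₂

def P₂₁ : TransferMatrix q₂ p₁ := realization P.A P.B₁ P.C₂ P.D₂₁

/-- `P₁₁ + P₁₂ Q P₂₁`. -/
def closedLoop (Q : TransferMatrix p₂ q₂) : TransferMatrix q₁ p₁ :=
  P.P₁₁ + P.P₁₂ * Q * P.P₂₁

/-- `Ω = D₁₂ᵀ D₁₂ + B₂ᵀ X B₂`. -/
def Om (X : Matrix (Fin n) (Fin n) ℝ) : Matrix (Fin p₂) (Fin p₂) ℝ :=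
  P.D₁₂ᵀ * P.D₁₂ + P.B₂ᵀ * X * P.B₂

/-- The regulator gain `K = -Ω⁻¹ (B₂ᵀ X A + D₁₂ᵀ C₁)`. -/
def K (X : Matrix (Fin n) (Fin n) ℝ) : Matrix (Fin p₂) (Fin n) ℝ :=
  -((P.Om X)⁻¹ * (P.B₂ᵀ * X * P.A + P.D₁₂ᵀ * P.C₁))

/-- `X` is a stabilizing solution of the control Riccati equation. -/
structure IsStabilizingControl (X : Matrix (Fin n) (Fin n) ℝ) : Prop where
  symm : X.IsSymm
  isUnit_det : IsUnit (P.Om X).det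
  riccati : X = P.C₁ᵀ * P.C₁ + P.Aᵀ * X * P.A -
    (P.Aᵀ * X * P.B₂ + P.C₁ᵀ * P.D₁₂) * (P.Om X)⁻¹ * (P.B₂ᵀ * X * P.A + P.D₁₂ᵀ * P.C₁)
  stable : SchurStable (P.A + P.B₂ * P.K X)

/-- `Ψ = D₂₁ D₂₁ᵀ + C₂ Y C₂ᵀ`. -/
def Psi (Y : Matrix (Fin n) (Fin n) ℝ) : Matrix (Fin q₂) (Fin q₂) ℝ :=
  P.D₂₁ * P.D₂₁ᵀ + P.C₂ * Y * P.C₂ᵀ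

/-- The filter gain `L = -(A Y C₂ᵀ + B₁ D₂₁ᵀ) Ψ⁻¹`. -/
def L (Y : Matrix (Fin n) (Fin n) ℝ) : Matrix (Fin n) (Fin q₂) ℝ :=
  -((P.A * Y * P.C₂ᵀ + P.B₁ * P.D₂₁ᵀ) * (P.Psi Y)⁻¹)

/-- `Y` is a stabilizing solution of the estimation Riccati equation. -/
structure IsStabilizingEstimation (Y : Matrix (Fin n) (Fin n) ℝ) : Prop where
  symm : Y.IsSymm
  isUnit_det : IsUnit (P.Psi Y).det
  riccati : Y = P.B₁ * P.B₁ᵀ + P.A * Y * P.Aᵀ -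
    (P.A * Y * P.C₂ᵀ + P.B₁ * P.D₂₁ᵀ) * (P.Psi Y)⁻¹ * (P.C₂ * Y * P.Aᵀ + P.D₂₁ * P.B₁ᵀ)
  stable : SchurStable (P.A + P.L Y * P.C₂)

/-- `W_L = (I + K (zI - A - B₂ K)⁻¹ B₂) Ω^{-1/2}`. -/
def WL (X : Matrix (Fin n) (Fin n) ℝ) : TransferMatrix p₂ p₂ :=
  realization (P.A + P.B₂ * P.K X) P.B₂ (P.K X) 1 * const (matSqrt (P.Om X))⁻¹

/-- `W_R = Ψ^{-1/2} (I + C₂ (zI - A - L C₂)⁻¹ L)`. -/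
def WR (Y : Matrix (Fin n) (Fin n) ℝ) : TransferMatrix q₂ q₂ :=
  const (matSqrt (P.Psi Y))⁻¹ * realization (P.A + P.L Y * P.C₂) (P.L Y) P.C₂ 1

/-- `T = Ω^{1/2} K (zI - A)⁻¹ L Ψ^{1/2}`. -/
def T (X Y : Matrix (Fin n) (Fin n) ℝ) : TransferMatrix p₂ q₂ :=
  const (matSqrt (P.Om X)) * realization P.A (P.L Y) (P.K X) 0 * const (matSqrt (P.Psi Y))

/-- `Q_N = -W_L P_{z^{-(N+1)} H₂}(T) W_R`. -/
def QN (X Y : Matrix (Fin n) (Fin n) ℝ) (N : ℕ) : TransferMatrix p₂ q₂ :=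
  -(P.WL X * projShift (N + 1) (P.T X Y) * P.WR Y)

/-- `W_L⁻¹ V W_R⁻¹`. Here `⁻¹` is the inverse of square matrices over the ring of power series
in `z⁻¹`; the constant terms of `W_L` and `W_R` are invertible. -/
def weighted (X Y : Matrix (Fin n) (Fin n) ℝ) (V : TransferMatrix p₂ q₂) :
    TransferMatrix p₂ q₂ :=
  (P.WL X)⁻¹ * V * (P.WR Y)⁻¹

/-- `‖P_𝒳(W_L⁻¹ V W_R⁻¹)‖² + 2 ⟨P_𝒳(W_L⁻¹ V W_R⁻¹), T⟩`; the inner product is real for the `V`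
with real coefficients to which this is applied. -/
def firCost (X Y : Matrix (Fin n) (Fin n) ℝ) (N : ℕ) (V : TransferMatrix p₂ q₂) : ℝ :=
  h2Norm (projFIR N (P.weighted X Y V)) ^ 2 +
    2 * (h2Inner (projFIR N (P.weighted X Y V)) (P.T X Y)).re

/-- `U(V) = Q_N - W_L P_{z^{-(N+1)} H₂}(W_L⁻¹ V W_R⁻¹) W_R`. -/
def U (X Y : Matrix (Fin n) (Fin n) ℝ) (N : ℕ) (V : TransferMatrix p₂ q₂) :
    TransferMatrix p₂ q₂ :=
  P.QN X Y N - P.WL X * projShift (N + 1) (P.weighted X Y V) * P.WR Y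

end Plant

/-- `x` is the unique minimizer of `f` on `s`. -/
def IsUniqueMinimizer {α : Type*} (f : α → ℝ) (s : Set α) (x : α) : Prop :=
  x ∈ s ∧ ∀ y ∈ s, y ≠ x → f x < f y

end ModelMatching

end

/-! Everything rests on one identity: for strictly proper `Q` in H₂, ‖P₁₁ + P₁₂ Q P₂₁‖² = c + ‖W_L⁻¹
Q W_R⁻¹ + T‖², with `c` independent of `Q` (`exists_normSq_closedLoop`). It replaces spectral
factorization by completion of squares in the time domain: along a state trajectory the control
Riccati equation turns the output energy into the energy of Ω^{1/2}(u - Kx) plus a telescoping term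
(`completion_of_squares`, `exists_normSq_eq_add_normSq`). One application strips P₁₂ from the left.
What remains is, up to sign and transposition, the same problem for the transposed plant, whose
control Riccati equation is the estimation equation; a second application strips P₂₁.

Given the identity, split W_L⁻¹ Q W_R⁻¹ + T at index N + 1. The weights and their inverses are
causal, so the coefficients up to N depend only on the FIR part `V` of `Q` (`sub_projShift_congr`),
while the rest of `Q` can cancel the tail exactly: this is `U V`, and `Q_N` is the case V = 0
(`normSq_closedLoop_lt`). What is left is the squared norm of the coefficients 1, …, N, which
differs from `firCost` by a constant (`firCost_eq`). It is a least squares problem in finite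
dimension, and the map V ↦ P_𝒳(W_L⁻¹ V W_R⁻¹) is injective, so its minimizer exists and is unique
(`exists_norm_add_lt`).

Membership of `U V + V` in 𝒮 requires a real rational tail. Proper rational series form a ring that
contains all realizations and is closed under deleting initial coefficients
(`isProperRational_resolv`, `tail_mem_properRational`). -/

namespace ModelMatching

/-! ### Summability of coefficients and the norm of H₂. -/

namespace TransferMatrix

/-- The coefficients of `g` are absolutely summable. -/
def AbsSummable (g : ℂ⟦X⟧) : Prop := Summable fun i => ‖PowerSeries.coeff i g‖

/-- The coefficients of `g` are square summable. -/
def SqSummable (g : ℂ⟦X⟧) : Prop := Summable fun i => ‖PowerSeries.coeff i g‖ ^ 2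

/-- Cauchy–Schwarz after writing |f||g| as |f|^{1/2} · |f|^{1/2}|g|. -/
theorem sq_norm_sum_mul_le {ι : Type*} (s : Finset ι) (f g : ι → ℂ) :
    ‖∑ i ∈ s, f i * g i‖ ^ 2 ≤ (∑ i ∈ s, ‖f i‖) * ∑ i ∈ s, ‖f i‖ * ‖g i‖ ^ 2 := by
  have h1 : ‖∑ i ∈ s, f i * g i‖ ≤ ∑ i ∈ s, ‖f i‖ * ‖g i‖ :=
    (norm_sum_le _ _).trans (by simp)
  refine (pow_le_pow_left₀ (norm_nonneg _) h1 2).trans ?_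
  refine Finset.sum_sq_le_sum_mul_sum_of_sq_le_mul s (fun i _ => norm_nonneg _)
    (fun i _ => by positivity) fun i _ => le_of_eq (by ring)

/-- Young's inequality ℓ¹ * ℓ² ⊆ ℓ²: the weighted Cauchy–Schwarz bound dominates |(fg)ₖ|² by ‖f‖₁
times the k-th term of the Cauchy product of |f| and |g|², two summable sequences. This is why
stable systems act on H₂. -/
theorem AbsSummable.mul_sqSummable {f g : ℂ⟦X⟧} (hf : AbsSummable f) (hg : SqSummable g) :
    SqSummable (f * g) := by
  have h := summable_norm_sum_mul_antidiagonal_of_summable_norm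
    (f := fun i => ‖PowerSeries.coeff i f‖) (g := fun i => ‖PowerSeries.coeff i g‖ ^ 2)
    (by simpa [AbsSummable] using hf) (by simpa [SqSummable] using hg)
  refine (h.mul_left (∑' i, ‖PowerSeries.coeff i f‖)).of_nonneg_of_le
    (fun _ => by positivity) fun k => ?_
  rw [PowerSeries.coeff_mul]
  refine (sq_norm_sum_mul_le _ _ _).trans ?_
  rw [Real.norm_of_nonneg (Finset.sum_nonneg fun i _ => by positivity)]
  refine mul_le_mul_of_nonneg_right ?_ (Finset.sum_nonneg fun i _ => by positivity)
  rw [Finset.Nat.sum_antidiagonal_eq_sum_range_succ_mk]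
  exact hf.sum_le_tsum _ fun i _ => norm_nonneg _

theorem SqSummable.add {f g : ℂ⟦X⟧} (hf : SqSummable f) (hg : SqSummable g) :
    SqSummable (f + g) := by
  refine ((Summable.add hf hg).mul_left 2).of_nonneg_of_le (fun _ => by positivity) fun k => ?_
  rw [map_add]
  have h := norm_add_le (PowerSeries.coeff k f) (PowerSeries.coeff k g)
  nlinarith [norm_nonneg (PowerSeries.coeff k f + PowerSeries.coeff k g),
    sq_nonneg (‖PowerSeries.coeff k f‖ - ‖PowerSeries.coeff k g‖)]

theorem sqSummable_zero : SqSummable 0 := by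
  simp [SqSummable, summable_zero]

theorem sqSummable_one : SqSummable 1 :=
  summable_of_ne_finset_zero (s := {0}) fun i hi => by
    have : i ≠ 0 := by simpa using hi
    simp [PowerSeries.coeff_one, this]

theorem SqSummable.sum {ι : Type*} (s : Finset ι) {f : ι → ℂ⟦X⟧}
    (hf : ∀ i ∈ s, SqSummable (f i)) : SqSummable (∑ i ∈ s, f i) :=
  Finset.sum_induction _ SqSummable (fun _ _ => SqSummable.add) sqSummable_zero hf

theorem AbsSummable.sqSummable {f : ℂ⟦X⟧} (hf : AbsSummable f) : SqSummable f := by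
  simpa using hf.mul_sqSummable sqSummable_one

/-- All entries of `G` have absolutely summable coefficients. -/
def Stable {p q : ℕ} (G : TransferMatrix p q) : Prop := ∀ i j, AbsSummable (G i j)

/-- The squared Frobenius norm of a matrix. -/
noncomputable def frobSq {p q : ℕ} (M : Matrix (Fin p) (Fin q) ℂ) : ℝ := ∑ a, ∑ b, ‖M a b‖ ^ 2

/-- The squared `H₂` norm. -/
noncomputable def normSq {p q : ℕ} (G : TransferMatrix p q) : ℝ := ∑' i, frobSq (coef G i)

variable {n p q r : ℕ}

theorem trace_mul_conjTranspose (M : Matrix (Fin p) (Fin q) ℂ) :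
    (M * M.conjTranspose).trace = (frobSq M : ℂ) := by
  simp [frobSq, Matrix.trace, Matrix.mul_apply, Complex.mul_conj, Complex.normSq_eq_norm_sq]

theorem frobSq_nonneg (M : Matrix (Fin p) (Fin q) ℂ) : 0 ≤ frobSq M :=
  Finset.sum_nonneg fun _ _ => Finset.sum_nonneg fun _ _ => by positivity

theorem frobSq_eq_zero {M : Matrix (Fin p) (Fin q) ℂ} (h : frobSq M = 0) : M = 0 := by
  ext a b
  have h1 := (Finset.sum_eq_zero_iff_of_nonneg
    (fun a _ => Finset.sum_nonneg fun b _ => by positivity)).mp h a (Finset.mem_univ _)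
  have h2 := (Finset.sum_eq_zero_iff_of_nonneg (fun b _ => by positivity)).mp h1 b
    (Finset.mem_univ _)
  simpa using h2

theorem frobSq_zero : frobSq (0 : Matrix (Fin p) (Fin q) ℂ) = 0 := by
  simp [frobSq]

theorem frobSq_neg (M : Matrix (Fin p) (Fin q) ℂ) : frobSq (-M) = frobSq M := by
  simp [frobSq]

theorem frobSq_transpose (M : Matrix (Fin p) (Fin q) ℂ) : frobSq M.transpose = frobSq M := by
  simp only [frobSq, Matrix.transpose_apply]
  exact Finset.sum_comm

theorem inH2_iff_frobSq {G : TransferMatrix p q} :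
    InH2 G ↔ Summable fun i => frobSq (coef G i) := by
  unfold InH2
  simp_rw [trace_mul_conjTranspose]
  exact Complex.summable_ofReal

theorem inH2_iff {G : TransferMatrix p q} : InH2 G ↔ ∀ a b, SqSummable (G a b) := by
  rw [inH2_iff_frobSq]
  constructor
  · intro h a b
    refine h.of_nonneg_of_le (fun _ => by positivity) fun i => ?_
    refine le_trans ?_ (Finset.single_le_sum (f := fun a => ∑ b, ‖coef G i a b‖ ^ 2)
      (fun a _ => Finset.sum_nonneg fun b _ => by positivity) (Finset.mem_univ a))
    exact Finset.single_le_sum (f := fun b => ‖coef G i a b‖ ^ 2)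
      (fun b _ => by positivity) (Finset.mem_univ b)
  · intro h
    exact summable_sum fun a _ => summable_sum fun b _ => h a b

theorem h2Inner_self (G : TransferMatrix p q) : h2Inner G G = (normSq G : ℂ) := by
  unfold h2Inner normSq
  simp_rw [trace_mul_conjTranspose]
  exact (Complex.ofReal_tsum _).symm

theorem normSq_nonneg (G : TransferMatrix p q) : 0 ≤ normSq G :=
  tsum_nonneg fun _ => frobSq_nonneg _

theorem h2Norm_eq (G : TransferMatrix p q) : h2Norm G = Real.sqrt (normSq G) := by
  rw [h2Norm, h2Inner_self, Complex.ofReal_re]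

theorem h2Norm_sq (G : TransferMatrix p q) : h2Norm G ^ 2 = normSq G := by
  rw [h2Norm_eq, Real.sq_sqrt (normSq_nonneg G)]

theorem ext_coef {G H : TransferMatrix p q} (h : ∀ i, coef G i = coef H i) : G = H := by
  ext a b i
  exact congrFun (congrFun (h i) a) b

theorem normSq_eq_zero {G : TransferMatrix p q} (hG : InH2 G) (h : normSq G = 0) : G = 0 := by
  refine ext_coef fun i => ?_
  have h1 := (hasSum_zero_iff_of_nonneg fun i => frobSq_nonneg (coef G i)).mp
    ((inH2_iff_frobSq.mp hG).hasSum_iff.mpr h)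
  rw [frobSq_eq_zero (congrFun h1 i)]
  ext; simp [coef]

theorem coef_add (G H : TransferMatrix p q) (i : ℕ) : coef (G + H) i = coef G i + coef H i := by
  ext; simp [coef]

theorem coef_zero (i : ℕ) : coef (0 : TransferMatrix p q) i = 0 := by
  ext; simp [coef]

theorem coef_neg (G : TransferMatrix p q) (i : ℕ) : coef (-G) i = -coef G i := by
  ext; simp [coef]

theorem coef_transpose (G : TransferMatrix p q) (i : ℕ) :
    coef G.transpose i = (coef G i).transpose := rfl

theorem coef_const_mul (M : Matrix (Fin p) (Fin q) ℝ) (G : TransferMatrix q r) (i : ℕ) :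
    coef (const M * G) i = M.map Complex.ofReal * coef G i := by
  ext; simp [coef, const, Matrix.mul_apply]

theorem coef_X_pow_smul (k : ℕ) (G : TransferMatrix p q) (i : ℕ) :
    coef ((PowerSeries.X ^ k : ℂ⟦X⟧) • G) i = if k ≤ i then coef G (i - k) else 0 := by
  ext a b
  by_cases h : k ≤ i <;> simp [coef, PowerSeries.coeff_X_pow_mul', h]

theorem coef_mul (G : TransferMatrix p q) (H : TransferMatrix q r) (i : ℕ) :
    coef (G * H) i = ∑ x ∈ Finset.HasAntidiagonal.antidiagonal i, coef G x.1 * coef H x.2 := by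
  ext a b
  simp only [coef, Matrix.map_apply, Matrix.mul_apply, map_sum, PowerSeries.coeff_mul,
    Matrix.sum_apply]
  exact Finset.sum_comm

theorem normSq_neg (G : TransferMatrix p q) : normSq (-G) = normSq G := by
  simp [normSq, coef_neg, frobSq_neg]

theorem normSq_transpose (G : TransferMatrix p q) : normSq G.transpose = normSq G := by
  simp [normSq, coef_transpose, frobSq_transpose]

theorem InH2.add {G H : TransferMatrix p q} (hG : InH2 G) (hH : InH2 H) : InH2 (G + H) := by
  rw [inH2_iff] at *
  exact fun a b => (hG a b).add (hH a b)

theorem InH2.neg {G : TransferMatrix p q} (hG : InH2 G) : InH2 (-G) := by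
  rw [inH2_iff_frobSq] at *
  simpa [coef_neg, frobSq_neg] using hG

theorem InH2.sub {G H : TransferMatrix p q} (hG : InH2 G) (hH : InH2 H) : InH2 (G - H) := by
  rw [sub_eq_add_neg]
  exact hG.add hH.neg

theorem inH2_zero : InH2 (0 : TransferMatrix p q) := by
  rw [inH2_iff]
  exact fun _ _ => sqSummable_zero

theorem InH2.transpose {G : TransferMatrix p q} (hG : InH2 G) : InH2 G.transpose := by
  rw [inH2_iff] at *
  exact fun a b => hG b a

theorem Stable.transpose {G : TransferMatrix p q} (hG : Stable G) : Stable G.transpose :=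
  fun a b => hG b a

theorem Stable.inH2 {G : TransferMatrix p q} (hG : Stable G) : InH2 G :=
  inH2_iff.mpr fun a b => (hG a b).sqSummable

theorem Stable.mul_inH2 {G : TransferMatrix p q} {H : TransferMatrix q r} (hG : Stable G)
    (hH : InH2 H) : InH2 (G * H) := by
  rw [inH2_iff] at *
  exact fun a b => SqSummable.sum _ fun j _ => (hG a j).mul_sqSummable (hH j b)

theorem InH2.mul_stable {G : TransferMatrix p q} {H : TransferMatrix q r} (hG : InH2 G)
    (hH : Stable H) : InH2 (G * H) := by
  have := (hH.transpose.mul_inH2 hG.transpose).transpose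
  rwa [← Matrix.transpose_mul, Matrix.transpose_transpose] at this

theorem stable_const (M : Matrix (Fin p) (Fin q) ℝ) : Stable (const M) := fun a b =>
  summable_of_ne_finset_zero (s := {0}) fun i hi => by
    have : i ≠ 0 := by simpa using hi
    simp [const, PowerSeries.coeff_C, this]

theorem Stable.const_mul {G : TransferMatrix q r} (hG : Stable G)
    (M : Matrix (Fin p) (Fin q) ℝ) : Stable (const M * G) := by
  intro a b
  have : Summable fun i => ∑ j, ‖M a j‖ * ‖PowerSeries.coeff i (G j b)‖ :=
    summable_sum fun j _ => (hG j b).mul_left _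
  refine this.of_nonneg_of_le (fun _ => norm_nonneg _) fun i => ?_
  rw [Matrix.mul_apply, map_sum]
  refine (norm_sum_le _ _).trans (le_of_eq ?_)
  simp [const]

theorem Stable.mul_const {G : TransferMatrix p q} (hG : Stable G)
    (M : Matrix (Fin q) (Fin r) ℝ) : Stable (G * const M) := by
  have := (hG.transpose.const_mul M.transpose).transpose
  have h : const M.transpose = (const M).transpose := rfl
  rwa [h, ← Matrix.transpose_mul, Matrix.transpose_transpose] at this

theorem InH2.projShift {G : TransferMatrix p q} (hG : InH2 G) (k : ℕ) :
    InH2 (projShift k G) := (projShift_isOrthogonalProjection k G hG).1.1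

/-- Pythagoras: at each index one of the two summands has zero coefficient. -/
theorem normSq_eq_add_projShift {G : TransferMatrix p q} (hG : InH2 G) (k : ℕ) :
    normSq G = normSq (G - projShift k G) + normSq (projShift k G) := by
  have h1 := inH2_iff_frobSq.mp (hG.sub (hG.projShift k))
  have h2 := inH2_iff_frobSq.mp (hG.projShift k)
  rw [normSq, normSq, normSq, ← h1.tsum_add h2]
  congr 1; ext i
  by_cases h : k ≤ i <;> simp [coef_sub, coef_projShift, h, frobSq_zero]

end TransferMatrix

open TransferMatrix

/-! ### Powers of Schur stable matrices. -/

section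

attribute [local instance] Matrix.linftyOpNormedRing Matrix.linftyOpNormedAlgebra

/-- Gelfand's formula: ‖Mᵏ‖^{1/k} tends to the spectral radius, so ‖Mᵏ‖ ≤ rᵏ eventually, for any r <
1 above that radius. -/
theorem SchurStable.summable_norm_pow {n : ℕ} {A : Matrix (Fin n) (Fin n) ℝ}
    (hA : SchurStable A) : Summable fun k => ‖A.map Complex.ofReal ^ k‖ := by
  -- For n = 0 the matrix algebra is trivial and is treated separately from the spectral argument.
  rcases isEmpty_or_nonempty (Fin n) with hn | hn
  · have : Subsingleton (Matrix (Fin n) (Fin n) ℂ) := inferInstance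
    simp [Subsingleton.elim _ (0 : Matrix (Fin n) (Fin n) ℂ), summable_zero]
  · set M := A.map Complex.ofReal with hM
    have h1 : spectralRadius ℂ M < (1 : NNReal) :=
      spectrum.spectralRadius_lt_of_forall_lt M fun μ hμ => by
        simpa [← NNReal.coe_lt_coe] using hA μ hμ
    obtain ⟨r, hr1, hr2⟩ := ENNReal.lt_iff_exists_nnreal_btwn.mp h1
    have h2 := (spectrum.pow_nnnorm_pow_one_div_tendsto_nhds_spectralRadius M).eventually
      (gt_mem_nhds hr1)
    have hr : (r : ℝ) < 1 := by exact_mod_cast hr2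
    refine Summable.of_norm_bounded_eventually_nat
      (summable_geometric_of_lt_one r.coe_nonneg hr) ?_
    filter_upwards [h2, Filter.eventually_ge_atTop 1] with k hk hk1
    have hk0 : (0 : ℝ) < k := by exact_mod_cast hk1
    rw [norm_norm]
    have h3 : (‖M ^ k‖₊ : ENNReal) ≤ (r : ENNReal) ^ (k : ℝ) := by
      have := ENNReal.rpow_le_rpow hk.le hk0.le
      rwa [← ENNReal.rpow_mul, one_div, inv_mul_cancel₀ hk0.ne', ENNReal.rpow_one] at this
    rw [ENNReal.rpow_natCast] at h3
    exact_mod_cast h3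

theorem SchurStable.summable_norm_pow_apply {n : ℕ} {A : Matrix (Fin n) (Fin n) ℝ}
    (hA : SchurStable A) (i j : Fin n) : Summable fun k => ‖(A ^ k) i j‖ := by
  refine hA.summable_norm_pow.of_nonneg_of_le (fun _ => norm_nonneg _) fun k => ?_
  have h : (A.map Complex.ofReal ^ k) i j = (((A ^ k) i j : ℝ) : ℂ) := by
    have h1 : A.map Complex.ofReal ^ k = (A ^ k).map Complex.ofReal :=
      (map_pow Complex.ofRealHom.mapMatrix A k).symm
    rw [h1, Matrix.map_apply]
  have h2 : ‖(A ^ k) i j‖ = ‖(A.map Complex.ofReal ^ k) i j‖ := by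
    rw [h, Complex.norm_real]
  rw [h2, Matrix.linfty_opNorm_def]
  refine le_trans ?_ (NNReal.coe_le_coe.mpr (Finset.le_sup (f := fun i =>
    ∑ j, ‖(A.map Complex.ofReal ^ k) i j‖₊) (Finset.mem_univ i)))
  rw [← coe_nnnorm, NNReal.coe_le_coe]
  exact Finset.single_le_sum (f := fun j => ‖(A.map Complex.ofReal ^ k) i j‖₊)
    (fun _ _ => zero_le) (Finset.mem_univ j)

end

theorem SchurStable.transpose {n : ℕ} {A : Matrix (Fin n) (Fin n) ℝ}
    (hA : SchurStable A) : SchurStable A.transpose := by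
  intro μ hμ
  refine hA μ ?_
  have h : A.transpose.map Complex.ofReal = (A.map Complex.ofReal).transpose := rfl
  rw [h, Matrix.mem_spectrum_iff_isRoot_charpoly, Matrix.charpoly_transpose] at hμ
  exact Matrix.mem_spectrum_iff_isRoot_charpoly.mpr hμ

/-! ### The resolvent and state-space realizations. -/

variable {n p q r : ℕ}

/-- The transfer matrix `(zI - A)⁻¹`. -/
noncomputable def TransferMatrix.resolv (A : Matrix (Fin n) (Fin n) ℝ) : TransferMatrix n n :=
  realization A (1 : Matrix (Fin n) (Fin n) ℝ) (1 : Matrix (Fin n) (Fin n) ℝ) 0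

/-- Confines the dynamics to `resolv A`, so that stability, rationality and algebraic identities
need to be checked only there. -/
theorem TransferMatrix.realization_factor (A : Matrix (Fin n) (Fin n) ℝ)
    (B : Matrix (Fin n) (Fin q) ℝ) (C : Matrix (Fin p) (Fin n) ℝ)
    (D : Matrix (Fin p) (Fin q) ℝ) :
    realization A B C D = const C * resolv A * const B + const D := by
  refine ext_coef fun k => ?_
  rw [resolv]
  unfold realization
  simp only [mul_one, one_mul]
  cases k <;> ext a b <;> simp [coef, const, Matrix.mul_apply]

theorem TransferMatrix.resolv_eq (A : Matrix (Fin n) (Fin n) ℝ) :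
    resolv A = (PowerSeries.X : ℂ⟦X⟧) • (1 + const A * resolv A) := by
  rw [resolv]
  unfold realization
  simp only [mul_one, one_mul]
  refine ext_coef fun k => ?_
  rw [← pow_one PowerSeries.X, coef_X_pow_smul, coef_add, coef_const_mul]
  cases k with
  | zero => ext a b; simp [coef]
  | succ k =>
    ext a b
    cases k with
    | zero => by_cases h : a = b <;> simp [coef, Matrix.mul_apply, h]
    | succ k => simp [coef, Matrix.mul_apply, pow_succ' A,
        Matrix.one_apply, apply_ite]

theorem TransferMatrix.sub_mul_resolv (A : Matrix (Fin n) (Fin n) ℝ) :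
    (1 - (PowerSeries.X : ℂ⟦X⟧) • const A) * resolv A = (PowerSeries.X : ℂ⟦X⟧) • 1 := by
  rw [sub_mul, one_mul, Matrix.smul_mul, sub_eq_iff_eq_add, ← smul_add]
  exact resolv_eq A

theorem SchurStable.stable_resolv {A : Matrix (Fin n) (Fin n) ℝ} (hA : SchurStable A) :
    Stable (resolv A) := by
  intro i j
  refine (summable_nat_add_iff 1).mp ?_
  simpa [realization, resolv] using hA.summable_norm_pow_apply i j

theorem TransferMatrix.Stable.add {G H : TransferMatrix p q} (hG : Stable G) (hH : Stable H) :
    Stable (G + H) := fun a b =>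
  (Summable.add (hG a b) (hH a b)).of_nonneg_of_le (fun _ => norm_nonneg _) fun i => by
    simpa using norm_add_le _ _

theorem SchurStable.stable_realization {A : Matrix (Fin n) (Fin n) ℝ} (hA : SchurStable A)
    (B : Matrix (Fin n) (Fin q) ℝ) (C : Matrix (Fin p) (Fin n) ℝ)
    (D : Matrix (Fin p) (Fin q) ℝ) : Stable (realization A B C D) := by
  rw [realization_factor]
  exact ((hA.stable_resolv.const_mul C).mul_const B).add (stable_const D)

end ModelMatching

/-! ### Riccati equations and completion of squares. -/

namespace ModelMatching

open TransferMatrix Matrix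

/-- `hK` matches the cross terms and `hric` the terms quadratic in `x`. A general star ring allows
two uses: over ℝ it yields a Lyapunov equation for `X`, over ℂ the energy balance along
trajectories. -/
theorem completion_of_squares {R : Type*} [CommRing R] [StarRing R] {n m p q : Type*} [Fintype n]
    [Fintype p] [Fintype q]
    {A X : Matrix n n R} {B : Matrix n p R} {C : Matrix q n R} {D : Matrix q p R}
    {K : Matrix p n R} {Om : Matrix p p R} (hX : Xᴴ = X)
    (hOm : Om = Dᴴ * D + Bᴴ * X * B) (hK : Om * K = -(Bᴴ * X * A + Dᴴ * C))
    (hric : X = Cᴴ * C + Aᴴ * X * A - Kᴴ * Om * K) (x : Matrix n m R) (u : Matrix p m R) :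
    (C * x + D * u)ᴴ * (C * x + D * u) + (A * x + B * u)ᴴ * X * (A * x + B * u) =
      xᴴ * X * x + (u - K * x)ᴴ * Om * (u - K * x) := by
  have hOmH : Omᴴ = Om := by
    rw [hOm]; simp [hX, Matrix.mul_assoc]
  have hK' : Kᴴ * Om = -(Aᴴ * X * B + Cᴴ * D) := by
    have := congrArg conjTranspose hK
    simpa [hOmH, hX, Matrix.mul_assoc] using this
  have h1 : (C * x + D * u)ᴴ * (C * x + D * u) + (A * x + B * u)ᴴ * X * (A * x + B * u) =
      xᴴ * (Cᴴ * C + Aᴴ * X * A) * x + xᴴ * (Aᴴ * X * B + Cᴴ * D) * u +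
        uᴴ * (Bᴴ * X * A + Dᴴ * C) * x + uᴴ * (Dᴴ * D + Bᴴ * X * B) * u := by
    simp only [conjTranspose_add, conjTranspose_mul, Matrix.mul_add, Matrix.add_mul,
      Matrix.mul_assoc]
    abel
  have h2 : (u - K * x)ᴴ * Om * (u - K * x) = uᴴ * Om * u - uᴴ * (Om * K) * x -
      xᴴ * (Kᴴ * Om) * u + xᴴ * (Kᴴ * Om * K) * x := by
    simp only [conjTranspose_sub, conjTranspose_mul, Matrix.mul_sub, Matrix.sub_mul,
      Matrix.mul_assoc]
    abel
  have h3 : Cᴴ * C + Aᴴ * X * A = X + Kᴴ * Om * K := by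
    rw [eq_sub_iff_add_eq] at hric
    exact hric.symm
  rw [h1, h2, h3, hK, hK', ← hOm, Matrix.mul_add, Matrix.add_mul]
  simp only [Matrix.mul_neg, Matrix.neg_mul]
  abel

namespace TransferMatrix

variable {n p q r : ℕ}

/-- A real matrix regarded as a complex one. -/
def toC (M : Matrix (Fin p) (Fin q) ℝ) : Matrix (Fin p) (Fin q) ℂ := M.map Complex.ofReal

theorem toC_mul (M : Matrix (Fin p) (Fin q) ℝ) (N : Matrix (Fin q) (Fin r) ℝ) :
    toC (M * N) = toC M * toC N := by
  ext; simp [toC, Matrix.mul_apply]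

theorem toC_add (M N : Matrix (Fin p) (Fin q) ℝ) : toC (M + N) = toC M + toC N := by
  ext; simp [toC]

theorem toC_sub (M N : Matrix (Fin p) (Fin q) ℝ) : toC (M - N) = toC M - toC N := by
  ext; simp [toC]

theorem toC_neg (M : Matrix (Fin p) (Fin q) ℝ) : toC (-M) = -toC M := by
  ext; simp [toC]

theorem toC_transpose (M : Matrix (Fin p) (Fin q) ℝ) : toC Mᵀ = (toC M)ᴴ := by
  ext; simp [toC]

theorem const_mul (M : Matrix (Fin p) (Fin q) ℝ) (N : Matrix (Fin q) (Fin r) ℝ) :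
    const (M * N) = const M * const N := by
  ext1 a b; simp [const, Matrix.mul_apply]

theorem const_add (M N : Matrix (Fin p) (Fin q) ℝ) : const (M + N) = const M + const N := by
  ext1 a b; simp [const]

theorem const_neg (M : Matrix (Fin p) (Fin q) ℝ) : const (-M) = -const M := by
  ext1 a b; simp [const]

theorem const_zero : const (0 : Matrix (Fin p) (Fin q) ℝ) = 0 := by
  ext1 a b; simp [const]

theorem const_one : const (1 : Matrix (Fin p) (Fin p) ℝ) = 1 := by
  ext1 a b; by_cases h : a = b <;> simp [const, Matrix.one_apply, h]

theorem const_transpose (M : Matrix (Fin p) (Fin q) ℝ) : const Mᵀ = (const M)ᵀ := rfl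

theorem realization_transpose (A : Matrix (Fin n) (Fin n) ℝ)
    (B : Matrix (Fin n) (Fin q) ℝ) (C : Matrix (Fin p) (Fin n) ℝ)
    (D : Matrix (Fin p) (Fin q) ℝ) : realization Aᵀ Cᵀ Bᵀ Dᵀ = (realization A B C D)ᵀ := by
  ext i j k
  cases k with
  | zero => simp [realization]
  | succ k =>
    have h : Bᵀ * Aᵀ ^ k * Cᵀ = (C * A ^ k * B)ᵀ := by
      rw [← Matrix.transpose_pow, Matrix.transpose_mul, Matrix.transpose_mul, Matrix.mul_assoc]
    simp [realization, h]

theorem coef_const_zero (M : Matrix (Fin p) (Fin q) ℝ) : coef (const M) 0 = toC M := by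
  ext; simp [coef, const, toC]

theorem coef_const_succ (M : Matrix (Fin p) (Fin q) ℝ) (k : ℕ) : coef (const M) (k + 1) = 0 := by
  ext; simp [coef, const]

theorem trace_conjTranspose_mul_self (M : Matrix (Fin p) (Fin q) ℂ) :
    (Mᴴ * M).trace = (frobSq M : ℂ) := by
  rw [Matrix.trace_mul_comm, trace_mul_conjTranspose]

theorem InH2.tendsto_coef {G : TransferMatrix p q} (hG : InH2 G) :
    Filter.Tendsto (coef G) Filter.atTop (nhds 0) := by
  rw [inH2_iff] at hG
  refine tendsto_pi_nhds.mpr fun a => tendsto_pi_nhds.mpr fun b => ?_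
  have h := (hG a b).tendsto_atTop_zero.sqrt
  simp only [Real.sqrt_sq (norm_nonneg _), Real.sqrt_zero] at h
  exact tendsto_zero_iff_norm_tendsto_zero.mpr h

end TransferMatrix

variable {n p₁ p₂ q₁ q₂ : ℕ}

theorem SchurStable.tendsto_pow {A : Matrix (Fin n) (Fin n) ℝ} (hA : SchurStable A) :
    Filter.Tendsto (fun k => A ^ k) Filter.atTop (nhds 0) :=
  tendsto_pi_nhds.mpr fun i => tendsto_pi_nhds.mpr fun j =>
    tendsto_zero_iff_norm_tendsto_zero.mpr (hA.summable_norm_pow_apply i j).tendsto_atTop_zero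

/-- Iterating the equation gives vᵀ X v ≥ (Aᵏv)ᵀ X (Aᵏv), and the right side tends to 0 by
stability. -/
theorem SchurStable.posSemidef_of_lyapunov {A X : Matrix (Fin n) (Fin n) ℝ} (hA : SchurStable A)
    (hX : X.IsSymm) {M : Matrix (Fin p₁) (Fin n) ℝ} (h : X = Mᵀ * M + Aᵀ * X * A) :
    X.PosSemidef := by
  have hXH : X.IsHermitian := by rwa [IsHermitian, conjTranspose_eq_transpose_of_trivial]
  refine PosSemidef.of_dotProduct_mulVec_nonneg hXH fun v => ?_
  have hmono : ∀ k, star v ⬝ᵥ (((A ^ k)ᵀ * X * A ^ k) *ᵥ v) ≤ star v ⬝ᵥ (X *ᵥ v) := by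
    intro k
    induction k with
    | zero => simp
    | succ k ih =>
      refine le_trans ?_ ih
      have h1 : (A ^ k)ᵀ * X * A ^ k =
          (M * A ^ k)ᴴ * (M * A ^ k) + (A ^ (k + 1))ᵀ * X * A ^ (k + 1) := by
        conv_lhs => rw [h]
        rw [conjTranspose_eq_transpose_of_trivial, pow_succ' A]
        simp only [transpose_mul, Matrix.mul_add, Matrix.add_mul, Matrix.mul_assoc]
      rw [h1, add_mulVec, dotProduct_add]
      exact le_add_of_nonneg_left
        ((posSemidef_conjTranspose_mul_self (M * A ^ k)).dotProduct_mulVec_nonneg v)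
  have hc : Continuous fun B : Matrix (Fin n) (Fin n) ℝ => star v ⬝ᵥ ((Bᵀ * X * B) *ᵥ v) := by
    fun_prop
  have hlim := (hc.tendsto 0).comp hA.tendsto_pow
  have h0 := le_of_tendsto' hlim hmono
  simpa using h0

namespace Plant

variable (P : Plant n p₁ p₂ q₁ q₂) {X : Matrix (Fin n) (Fin n) ℝ}

theorem Om_isSymm (hX : X.IsSymm) : (P.Om X)ᵀ = P.Om X := by
  simp [Om, Matrix.mul_assoc, hX.eq]

variable {P}

theorem IsStabilizingControl.Om_mul_K (hX : P.IsStabilizingControl X) :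
    P.Om X * P.K X = -(P.B₂ᵀ * X * P.A + P.D₁₂ᵀ * P.C₁) := by
  rw [K, Matrix.mul_neg, ← Matrix.mul_assoc, mul_nonsing_inv _ hX.isUnit_det, Matrix.one_mul]

theorem IsStabilizingControl.riccati_gain (hX : P.IsStabilizingControl X) :
    X = P.C₁ᵀ * P.C₁ + P.Aᵀ * X * P.A - (P.K X)ᵀ * P.Om X * P.K X := by
  have h1 : (P.K X)ᵀ * P.Om X = -(P.Aᵀ * X * P.B₂ + P.C₁ᵀ * P.D₁₂) := by
    have := congrArg transpose hX.Om_mul_K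
    simpa [P.Om_isSymm hX.symm, hX.symm.eq, Matrix.mul_assoc] using this
  conv_lhs => rw [hX.riccati]
  rw [h1, K]
  simp only [Matrix.mul_neg, Matrix.neg_mul, neg_neg, Matrix.mul_assoc]

theorem IsStabilizingControl.posSemidef (hX : P.IsStabilizingControl X) : X.PosSemidef := by
  refine hX.stable.posSemidef_of_lyapunov hX.symm (M := P.C₁ + P.D₁₂ * P.K X) ?_
  -- For x = 1 and u = K the square vanishes, leaving the Lyapunov equation of the closed loop A +
  -- B₂K.
  have h := completion_of_squares (A := P.A) (B := P.B₂) (C := P.C₁) (D := P.D₁₂)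
    (K := P.K X) (Om := P.Om X) (X := X) (by simpa using hX.symm.eq)
    (by simp [Om]) (by simpa using hX.Om_mul_K) (by simpa using hX.riccati_gain)
    1 (P.K X)
  simpa using h.symm

theorem IsStabilizingControl.posDef_Om (hX : P.IsStabilizingControl X)
    (hD : (P.D₁₂ᵀ * P.D₁₂).PosDef) : (P.Om X).PosDef := by
  rw [Om]
  refine hD.add_posSemidef ?_
  simpa using hX.posSemidef.conjTranspose_mul_mul_same P.B₂

end Plant

theorem isUnit_det_matSqrt {M : Matrix (Fin n) (Fin n) ℝ} (hM : M.PosDef) :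
    IsUnit (matSqrt M).det := by
  have h := congrArg det (matSqrt_spec hM.posSemidef).2
  rw [det_mul] at h
  exact isUnit_of_mul_isUnit_left (h ▸ hM.det_pos.ne'.isUnit)

theorem matSqrt_transpose {M : Matrix (Fin n) (Fin n) ℝ} (hM : M.PosDef) :
    (matSqrt M)ᵀ = matSqrt M := by
  simpa using (matSqrt_spec hM.posSemidef).1.1.eq

namespace Plant

variable (P : Plant n p₁ p₂ q₁ q₂) {X : Matrix (Fin n) (Fin n) ℝ}

/-- The inverse `Ω^{1/2} (I - K (zI - A)⁻¹ B₂)` of `W_L`. -/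
noncomputable def WLInv (X : Matrix (Fin n) (Fin n) ℝ) : TransferMatrix p₂ p₂ :=
  const (matSqrt (P.Om X)) * realization P.A P.B₂ (-P.K X) 1

variable {P}

/-- Energy balance for the state driven by an impulse through `F` and by the input `Z`. Summed over
time, the storage tr(xₖ* X xₖ) telescopes; it tends to 0 because the state is in H₂. As `Z` is
strictly proper, x₁ = F, so the constant tr(Fᵀ X F) does not depend on `Z`. `F` is arbitrary because
the lemma is applied to two different impulse matrices. -/
theorem exists_normSq_eq_add_normSq (hA : SchurStable P.A) (hX : P.IsStabilizingControl X)
    (hD : (P.D₁₂ᵀ * P.D₁₂).PosDef) {m : ℕ} (F : Matrix (Fin n) (Fin m) ℝ) :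
    ∃ c : ℝ, ∀ Z ∈ (shiftH2 1 : Set (TransferMatrix p₂ m)),
      normSq (realization P.A F P.C₁ 0 + P.P₁₂ * Z) =
        c + normSq (P.WLInv X * Z - const (matSqrt (P.Om X)) * realization P.A F (P.K X) 0) := by
  have hOm := hX.posDef_Om hD
  refine ⟨((toC F)ᴴ * toC X * toC F).trace.re, fun Z hZ => ?_⟩
  set S := matSqrt (P.Om X) with hS
  -- The state trajectory (zI - A)⁻¹(F + B₂Z).
  set x : TransferMatrix n m := resolv P.A * (const F + const P.B₂ * Z) with hx
  have hy : realization P.A F P.C₁ 0 + P.P₁₂ * Z = const P.C₁ * x + const P.D₁₂ * Z := by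
    rw [P₁₂, realization_factor, realization_factor P.A P.B₂, hx, const_zero]
    simp only [Matrix.mul_add, Matrix.add_mul, Matrix.mul_assoc, add_zero]
    abel
  have hv : P.WLInv X * Z - const S * realization P.A F (P.K X) 0 =
      const S * (Z - const (P.K X) * x) := by
    rw [WLInv, realization_factor, realization_factor P.A F, hx, const_zero, const_one, const_neg]
    simp only [Matrix.mul_add, Matrix.add_mul, Matrix.mul_assoc, add_zero, Matrix.mul_sub,
      Matrix.neg_mul, Matrix.mul_neg, Matrix.one_mul]
    abel
  have hxH : InH2 x := hA.stable_resolv.mul_inH2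
    ((stable_const F).inH2.add ((stable_const P.B₂).mul_inH2 hZ.1))
  have hyH : InH2 (const P.C₁ * x + const P.D₁₂ * Z) :=
    ((stable_const _).mul_inH2 hxH).add ((stable_const _).mul_inH2 hZ.1)
  have hvH : InH2 (const S * (Z - const (P.K X) * x)) :=
    (stable_const _).mul_inH2 (hZ.1.sub ((stable_const _).mul_inH2 hxH))
  rw [hy, hv]
  have hZ0 : coef Z 0 = 0 := hZ.2 0 one_pos
  have hxX : x = (PowerSeries.X ^ 1 : ℂ⟦X⟧) • (const F + const P.B₂ * Z + const P.A * x) := by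
    conv_lhs => rw [hx, resolv_eq, Matrix.smul_mul, Matrix.add_mul, Matrix.one_mul,
      Matrix.mul_assoc, ← hx, ← pow_one PowerSeries.X]
  have hx0 : coef x 0 = 0 := by
    rw [hxX, coef_X_pow_smul, if_neg (by omega)]
  have hxs : ∀ k, coef x (k + 1) = coef (const F) k + toC P.B₂ * coef Z k +
      toC P.A * coef x k := fun k => by
    conv_lhs => rw [hxX]
    rw [coef_X_pow_smul, if_pos (by omega), coef_add, coef_add, coef_const_mul, coef_const_mul]
    rfl
  have hx1 : coef x 1 = toC F := by
    rw [hxs 0, hx0, hZ0, coef_const_zero]; simp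
  have hyk : ∀ k, coef (const P.C₁ * x + const P.D₁₂ * Z) k =
      toC P.C₁ * coef x k + toC P.D₁₂ * coef Z k := fun k => by
    rw [coef_add, coef_const_mul, coef_const_mul]; rfl
  have hvk : ∀ k, coef (const S * (Z - const (P.K X) * x)) k =
      toC S * (coef Z k - toC (P.K X) * coef x k) := fun k => by
    rw [coef_const_mul, coef_sub, coef_const_mul]; rfl
  have hSS : (toC S)ᴴ * toC S = toC (P.Om X) := by
    rw [← toC_transpose, matSqrt_transpose hOm, ← toC_mul, (matSqrt_spec hOm.posSemidef).2]
  -- The balance starts at index 1: the impulse enters only in x₁, after which x follows the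
  -- recursion xₖ₊₁ = A xₖ + B₂ Zₖ.
  have hstep : ∀ k, frobSq (coef (const P.C₁ * x + const P.D₁₂ * Z) (k + 1)) =
      frobSq (coef (const S * (Z - const (P.K X) * x)) (k + 1)) +
        (((coef x (k + 1))ᴴ * toC X * coef x (k + 1)).trace.re -
          ((coef x (k + 2))ᴴ * toC X * coef x (k + 2)).trace.re) := fun k => by
    have h := completion_of_squares (A := toC P.A) (B := toC P.B₂) (C := toC P.C₁)
      (D := toC P.D₁₂) (K := toC (P.K X)) (Om := toC (P.Om X)) (X := toC X)
      (by rw [← toC_transpose, hX.symm.eq])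
      (by simp only [← toC_transpose, ← toC_mul, ← toC_add]; rfl)
      (by simp only [← toC_transpose, ← toC_mul, ← toC_add, ← toC_neg, hX.Om_mul_K])
      (by simp only [← toC_transpose, ← toC_mul, ← toC_add, ← toC_sub]
          exact congrArg toC hX.riccati_gain) (coef x (k + 1)) (coef Z (k + 1))
    have h2 : coef x (k + 2) = toC P.A * coef x (k + 1) + toC P.B₂ * coef Z (k + 1) := by
      rw [hxs (k + 1), coef_const_succ, zero_add, add_comm]
    rw [← h2] at h
    have h3 := congrArg (fun M => (trace M).re) h
    have h4 : (coef Z (k + 1) - toC (P.K X) * coef x (k + 1))ᴴ * toC (P.Om X) *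
        (coef Z (k + 1) - toC (P.K X) * coef x (k + 1)) =
        (toC S * (coef Z (k + 1) - toC (P.K X) * coef x (k + 1)))ᴴ *
          (toC S * (coef Z (k + 1) - toC (P.K X) * coef x (k + 1))) := by
      rw [← hSS, conjTranspose_mul]; simp only [Matrix.mul_assoc]
    rw [h4] at h3
    simp only [trace_add, Complex.add_re, trace_conjTranspose_mul_self, Complex.ofReal_re] at h3
    rw [hyk, hvk]
    linarith
  have hfy := inH2_iff_frobSq.mp hyH
  have hfv := inH2_iff_frobSq.mp hvH
  have hlim : Filter.Tendsto (fun k => ((coef x k)ᴴ * toC X * coef x k).trace.re)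
      Filter.atTop (nhds 0) := by
    have hc : Continuous fun M : Matrix (Fin n) (Fin m) ℂ => (Mᴴ * toC X * M).trace.re := by
      fun_prop
    have h0 := (hc.tendsto 0).comp hxH.tendsto_coef
    simp only [Matrix.mul_zero, trace_zero, Complex.zero_re] at h0
    exact h0
  have hsum : ∀ M, ∑ k ∈ Finset.range M, frobSq (coef (const P.C₁ * x + const P.D₁₂ * Z) (k + 1)) =
      ∑ k ∈ Finset.range M, frobSq (coef (const S * (Z - const (P.K X) * x)) (k + 1)) +
        (((toC F)ᴴ * toC X * toC F).trace.re -
          ((coef x (M + 1))ᴴ * toC X * coef x (M + 1)).trace.re) := fun M => by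
    rw [Finset.sum_congr rfl fun k _ => hstep k, Finset.sum_add_distrib,
      Finset.sum_range_sub' fun k => ((coef x (k + 1))ᴴ * toC X * coef x (k + 1)).trace.re,
      zero_add, hx1]
  have hl1 := ((summable_nat_add_iff 1).mpr hfy).hasSum.tendsto_sum_nat
  have hl2 := ((summable_nat_add_iff 1).mpr hfv).hasSum.tendsto_sum_nat.add
    (tendsto_const_nhds (x := ((toC F)ᴴ * toC X * toC F).trace.re) |>.sub
      ((Filter.tendsto_add_atTop_iff_nat 1).mpr hlim))
  -- Both sides are limits of the same partial sums; the terms of index 0 vanish and are restored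
  -- afterwards.
  have h := tendsto_nhds_unique (hl1.congr hsum) hl2
  rw [normSq, normSq, hfy.tsum_eq_zero_add, hfv.tsum_eq_zero_add, h, hyk, hvk, hx0, hZ0]
  simp [frobSq_zero]
  ring

end Plant

end ModelMatching

/-! ### Inverses of the weights, duality and the cost identity. -/

namespace ModelMatching

open TransferMatrix Matrix

variable {n p q r p₁ p₂ q₁ q₂ : ℕ}

/-- State feedback u = Kx + v is undone by v = u - Kx. Algebraically this is the resolvent identity
for A + BK and A. -/
theorem TransferMatrix.mul_realization_feedback (A : Matrix (Fin n) (Fin n) ℝ)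
    (B : Matrix (Fin n) (Fin p) ℝ) (K : Matrix (Fin p) (Fin n) ℝ) :
    realization (A + B * K) B K 1 * realization A B (-K) 1 = 1 := by
  have hleft : resolv (A + B * K) - resolv A = resolv (A + B * K) * const (B * K) * resolv A := by
    -- The resolvent as a left factor, obtained by transposing `sub_mul_resolv` for the transposed
    -- matrix.
    have h1 : resolv (A + B * K) * (1 - (PowerSeries.X : ℂ⟦X⟧) • const (A + B * K)) =
        (PowerSeries.X : ℂ⟦X⟧) • 1 := by
      have h := sub_mul_resolv (A + B * K)ᵀ
      have h2 : (resolv (A + B * K)ᵀ) = (resolv (A + B * K))ᵀ := by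
        have := realization_transpose (A + B * K) (1 : Matrix (Fin n) (Fin n) ℝ)
          (1 : Matrix (Fin n) (Fin n) ℝ) 0
        simpa [resolv] using this
      rw [h2, const_transpose] at h
      have h3 := congrArg transpose h
      simpa [transpose_mul, transpose_sub] using h3
    have h2 := sub_mul_resolv A
    have hX : ∀ G H : TransferMatrix n n, (PowerSeries.X : ℂ⟦X⟧) • G =
        (PowerSeries.X : ℂ⟦X⟧) • H → G = H := fun G H h => by
      ext1 a b
      have := congrFun (congrFun h a) b
      simpa using this
    -- After multiplication by z⁻¹, each resolvent can be written as a product containing the other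
    -- one.
    apply hX
    have e1 : (PowerSeries.X : ℂ⟦X⟧) • resolv (A + B * K) = resolv (A + B * K) *
        ((1 - (PowerSeries.X : ℂ⟦X⟧) • const A) * resolv A) := by
      rw [h2]; simp
    have e2 : (PowerSeries.X : ℂ⟦X⟧) • resolv A = resolv (A + B * K) *
        (1 - (PowerSeries.X : ℂ⟦X⟧) • const (A + B * K)) * resolv A := by
      rw [h1]; simp
    rw [smul_sub, e1, e2, const_add]
    simp only [Matrix.sub_mul, Matrix.mul_sub, Matrix.one_mul, Matrix.mul_one, Matrix.smul_mul,
      Matrix.mul_smul, smul_add, Matrix.mul_add, Matrix.add_mul, Matrix.mul_assoc]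
    abel
  rw [realization_factor, realization_factor A, const_one, const_neg]
  have : (const K * resolv (A + B * K) * const B + 1) * (-const K * resolv A * const B + 1) =
      1 + const K * (resolv (A + B * K) - resolv A -
        resolv (A + B * K) * const (B * K) * resolv A) * const B := by
    rw [const_mul]
    simp only [Matrix.sub_mul, Matrix.mul_sub, Matrix.one_mul, Matrix.mul_one,
      Matrix.mul_add, Matrix.add_mul, Matrix.mul_assoc, Matrix.neg_mul, Matrix.mul_neg]
    abel
  rw [this, hleft]
  simp

namespace Plant

variable (P : Plant n p₁ p₂ q₁ q₂) {X Y : Matrix (Fin n) (Fin n) ℝ}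

/-- The transposed plant, which exchanges control and estimation. -/
def dual : Plant n q₁ q₂ p₁ p₂ where
  A := P.Aᵀ
  B₁ := P.C₁ᵀ
  B₂ := P.C₂ᵀ
  C₁ := P.B₁ᵀ
  C₂ := P.B₂ᵀ
  D₁₂ := P.D₂₁ᵀ
  D₂₁ := P.D₁₂ᵀ

theorem dual_Om (Y : Matrix (Fin n) (Fin n) ℝ) : P.dual.Om Y = P.Psi Y := by
  simp [dual, Om, Psi]

variable {P}

theorem IsStabilizingEstimation.dual_K (hY : P.IsStabilizingEstimation Y) :
    P.dual.K Y = (P.L Y)ᵀ := by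
  have h : (P.Psi Y)ᵀ = P.Psi Y := by
    rw [← dual_Om]; exact P.dual.Om_isSymm hY.symm
  rw [K, dual_Om, L, transpose_neg, transpose_mul, transpose_nonsing_inv, h]
  simp [dual, hY.symm.eq, Matrix.mul_assoc]

theorem IsStabilizingEstimation.dual (hY : P.IsStabilizingEstimation Y) :
    P.dual.IsStabilizingControl Y where
  symm := hY.symm
  isUnit_det := by rw [dual_Om]; exact hY.isUnit_det
  riccati := by
    rw [dual_Om]
    simpa [Plant.dual] using hY.riccati
  stable := by
    rw [hY.dual_K]
    have := hY.stable.transpose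
    simpa [Plant.dual, transpose_add, transpose_mul] using this

/-- Transfers stability and invertibility from the left weight of the dual plant to `WR`.
Definiteness of Ψ ensures that its square root is symmetric. -/
theorem IsStabilizingEstimation.WR_eq (hY : P.IsStabilizingEstimation Y)
    (hD : (P.D₂₁ * P.D₂₁ᵀ).PosDef) : P.WR Y = (P.dual.WL Y)ᵀ := by
  have hPsi : (P.Psi Y).PosDef := by
    rw [← dual_Om]
    exact hY.dual.posDef_Om (by simpa [Plant.dual] using hD)
  rw [WR, WL, transpose_mul, ← const_transpose, dual_Om, ← realization_transpose,
    transpose_nonsing_inv, matSqrt_transpose hPsi, hY.dual_K]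
  simp [Plant.dual]

theorem IsStabilizingControl.WL_mul_WLInv (hX : P.IsStabilizingControl X)
    (hD : (P.D₁₂ᵀ * P.D₁₂).PosDef) : P.WL X * P.WLInv X = 1 := by
  rw [WL, WLInv, Matrix.mul_assoc, ← Matrix.mul_assoc (const (matSqrt (P.Om X))⁻¹), ← const_mul,
    nonsing_inv_mul _ (isUnit_det_matSqrt (hX.posDef_Om hD)), const_one, Matrix.one_mul,
    mul_realization_feedback]

theorem IsStabilizingControl.WL_inv (hX : P.IsStabilizingControl X)
    (hD : (P.D₁₂ᵀ * P.D₁₂).PosDef) : (P.WL X)⁻¹ = P.WLInv X :=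
  inv_eq_right_inv (hX.WL_mul_WLInv hD)

theorem IsStabilizingControl.stable_WL (hX : P.IsStabilizingControl X) : Stable (P.WL X) :=
  (hX.stable.stable_realization _ _ _).mul_const _

theorem stable_WLInv (hA : SchurStable P.A) (X : Matrix (Fin n) (Fin n) ℝ) :
    Stable (P.WLInv X) :=
  (hA.stable_realization _ _ _).const_mul _

theorem weighted_add (X Y : Matrix (Fin n) (Fin n) ℝ) (V W : TransferMatrix p₂ q₂) :
    P.weighted X Y (V + W) = P.weighted X Y V + P.weighted X Y W := by
  simp only [weighted, Matrix.mul_add, Matrix.add_mul]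

/-- The standing assumptions on the plant and on the two Riccati solutions. -/
structure Regular (P : Plant n p₁ p₂ q₁ q₂) (X Y : Matrix (Fin n) (Fin n) ℝ) : Prop where
  stable : SchurStable P.A
  posDef_control : (P.D₁₂ᵀ * P.D₁₂).PosDef
  posDef_estimation : (P.D₂₁ * P.D₂₁ᵀ).PosDef
  control : P.IsStabilizingControl X
  estimation : P.IsStabilizingEstimation Y

namespace Regular

variable (h : P.Regular X Y)
include h

theorem posDef_dual : (P.dual.D₁₂ᵀ * P.dual.D₁₂).PosDef := by
  simpa [Plant.dual] using h.posDef_estimation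

theorem stable_WR : Stable (P.WR Y) := by
  rw [h.estimation.WR_eq h.posDef_estimation]
  exact h.estimation.dual.stable_WL.transpose

theorem WLInv_mul_WL : P.WLInv X * P.WL X = 1 :=
  mul_eq_one_comm.mp (h.control.WL_mul_WLInv h.posDef_control)

theorem WR_mul_inv : P.WR Y * (P.dual.WLInv Y)ᵀ = 1 := by
  rw [h.estimation.WR_eq h.posDef_estimation, ← transpose_mul,
    mul_eq_one_comm.mp (h.estimation.dual.WL_mul_WLInv h.posDef_dual), transpose_one]

theorem weighted_eq (V : TransferMatrix p₂ q₂) :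
    P.weighted X Y V = P.WLInv X * V * (P.dual.WLInv Y)ᵀ := by
  rw [weighted, h.control.WL_inv h.posDef_control, inv_eq_right_inv h.WR_mul_inv]

theorem weighted_WL_mul_WR (G : TransferMatrix p₂ q₂) :
    P.weighted X Y (P.WL X * G * P.WR Y) = G := by
  rw [h.weighted_eq, Matrix.mul_assoc, Matrix.mul_assoc (P.WL X * G), h.WR_mul_inv,
    Matrix.mul_one, ← Matrix.mul_assoc, h.WLInv_mul_WL, Matrix.one_mul]

theorem WL_mul_weighted_mul_WR (V : TransferMatrix p₂ q₂) :
    P.WL X * P.weighted X Y V * P.WR Y = V := by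
  rw [h.weighted_eq, Matrix.mul_assoc, Matrix.mul_assoc (P.WLInv X * V),
    mul_eq_one_comm.mp h.WR_mul_inv, Matrix.mul_one, ← Matrix.mul_assoc,
    h.control.WL_mul_WLInv h.posDef_control, Matrix.one_mul]

theorem stable_dual : SchurStable P.dual.A := h.stable.transpose

theorem inH2_weighted {V : TransferMatrix p₂ q₂} (hV : InH2 V) : InH2 (P.weighted X Y V) := by
  rw [h.weighted_eq]
  exact ((stable_WLInv h.stable X).mul_inH2 hV).mul_stable
    (stable_WLInv h.stable_dual Y).transpose

theorem inH2_T : InH2 (P.T X Y) :=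
  (((h.stable.stable_realization _ _ _).const_mul _).mul_const _).inH2

theorem inH2_closedLoop {Q : TransferMatrix p₂ q₂} (hQ : InH2 Q) : InH2 (P.closedLoop Q) :=
  (h.stable.stable_realization _ _ _).inH2.add
    (((h.stable.stable_realization _ _ _).mul_inH2 hQ).mul_stable
      (h.stable.stable_realization _ _ _))

end Regular

end Plant

theorem TransferMatrix.coef_mul_eq_zero_left {G : TransferMatrix p q} {k : ℕ}
    (hG : ∀ i < k, coef G i = 0) (H : TransferMatrix q r) : ∀ i < k, coef (G * H) i = 0 := by
  intro i hi
  rw [coef_mul]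
  refine Finset.sum_eq_zero fun x hx => ?_
  have := Finset.HasAntidiagonal.mem_antidiagonal.mp hx
  rw [hG x.1 (by omega), Matrix.zero_mul]

theorem TransferMatrix.coef_mul_eq_zero_right {H : TransferMatrix q r} {k : ℕ}
    (hH : ∀ i < k, coef H i = 0) (G : TransferMatrix p q) : ∀ i < k, coef (G * H) i = 0 := by
  intro i hi
  rw [coef_mul]
  refine Finset.sum_eq_zero fun x hx => ?_
  have := Finset.HasAntidiagonal.mem_antidiagonal.mp hx
  rw [hH x.2 (by omega), Matrix.mul_zero]

namespace Plant.Regular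

variable {P : Plant n p₁ p₂ q₁ q₂} {X Y : Matrix (Fin n) (Fin n) ℝ} (h : P.Regular X Y)
include h

theorem coef_weighted {V : TransferMatrix p₂ q₂} {k : ℕ} (hV : ∀ i < k, coef V i = 0) :
    ∀ i < k, coef (P.weighted X Y V) i = 0 := by
  rw [h.weighted_eq]
  exact coef_mul_eq_zero_left (coef_mul_eq_zero_right hV _) _

/-- Two energy balances. The first, with F = B₁ and Z = Q P₂₁, leaves W_L⁻¹ Q P₂₁ - Ω^{1/2} K (zI -
A)⁻¹ B₁. Its negative transpose is the output of the dual plant for F = (Ω^{1/2} K)ᵀ and Z = -(W_L⁻¹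
Q)ᵀ, and the second balance applies to that. -/
theorem exists_normSq_closedLoop : ∃ c : ℝ, ∀ Q ∈ (shiftH2 1 : Set (TransferMatrix p₂ q₂)),
    normSq (P.closedLoop Q) = c + normSq (P.weighted X Y Q + P.T X Y) := by
  obtain ⟨c₁, h₁⟩ := exists_normSq_eq_add_normSq h.stable h.control h.posDef_control P.B₁
  obtain ⟨c₂, h₂⟩ := exists_normSq_eq_add_normSq h.stable_dual h.estimation.dual h.posDef_dual
    (matSqrt (P.Om X) * P.K X)ᵀ
  refine ⟨c₁ + c₂, fun Q hQ => ?_⟩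
  have hOm := h.control.posDef_Om h.posDef_control
  have hPsi : (P.Psi Y).PosDef := by
    rw [← dual_Om]; exact h.estimation.dual.posDef_Om h.posDef_dual
  have hZ₁ : Q * P.P₂₁ ∈ (shiftH2 1 : Set (TransferMatrix p₂ p₁)) :=
    ⟨hQ.1.mul_stable (h.stable.stable_realization _ _ _), coef_mul_eq_zero_left hQ.2 _⟩
  have hZ₂ : -(P.WLInv X * Q)ᵀ ∈ (shiftH2 1 : Set (TransferMatrix q₂ p₂)) := by
    refine ⟨((stable_WLInv h.stable X).mul_inH2 hQ.1).transpose.neg, fun i hi => ?_⟩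
    rw [coef_neg, coef_transpose, coef_mul_eq_zero_right hQ.2 _ i hi]; simp
  have e₁ : P.closedLoop Q = realization P.A P.B₁ P.C₁ 0 + P.P₁₂ * (Q * P.P₂₁) := by
    rw [closedLoop, P₁₁, Matrix.mul_assoc]
  have e₂ : P.WLInv X * (Q * P.P₂₁) -
      const (matSqrt (P.Om X)) * realization P.A P.B₁ (P.K X) 0 =
      -(realization P.dual.A (matSqrt (P.Om X) * P.K X)ᵀ P.dual.C₁ 0 +
        P.dual.P₁₂ * -(P.WLInv X * Q)ᵀ)ᵀ := by
    have a₁ : realization P.dual.A (matSqrt (P.Om X) * P.K X)ᵀ P.dual.C₁ 0 =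
        (const (matSqrt (P.Om X)) * realization P.A P.B₁ (P.K X) 0)ᵀ := by
      rw [← transpose_zero, Plant.dual, realization_transpose, realization_factor,
        realization_factor P.A P.B₁ (P.K X)]
      simp only [const_mul, const_zero, add_zero, Matrix.mul_assoc]
    have a₂ : P.dual.P₁₂ = P.P₂₁ᵀ := realization_transpose _ _ _ _
    rw [a₁, a₂]
    simp only [Matrix.mul_neg, ← transpose_mul, transpose_add, transpose_neg,
      transpose_transpose, neg_add, neg_neg, Matrix.mul_assoc]
    abel
  have e₃ : P.dual.WLInv Y * -(P.WLInv X * Q)ᵀ - const (matSqrt (P.dual.Om Y)) *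
      realization P.dual.A (matSqrt (P.Om X) * P.K X)ᵀ (P.dual.K Y) 0 =
      -(P.weighted X Y Q + P.T X Y)ᵀ := by
    have a₁ : const (matSqrt (P.dual.Om Y)) *
        realization P.dual.A (matSqrt (P.Om X) * P.K X)ᵀ (P.dual.K Y) 0 = (P.T X Y)ᵀ := by
      rw [dual_Om, h.estimation.dual_K, ← transpose_zero, Plant.dual, realization_transpose,
        ← matSqrt_transpose hPsi, const_transpose, ← transpose_mul, T, realization_factor,
        realization_factor P.A (P.L Y) (P.K X)]
      simp only [const_mul, const_zero, add_zero, Matrix.mul_assoc]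
    rw [a₁, h.weighted_eq, Matrix.mul_neg, transpose_add, transpose_mul _ (P.dual.WLInv Y)ᵀ,
      transpose_transpose, neg_add, sub_eq_add_neg]
  rw [e₁, h₁ _ hZ₁, e₂, normSq_neg, normSq_transpose, h₂ _ hZ₂, e₃, normSq_neg, normSq_transpose,
    add_assoc]

end Plant.Regular

end ModelMatching

/-! ### Proper real rational transfer matrices. -/

namespace ModelMatching

open TransferMatrix Matrix

variable {n p q r p₁ p₂ q₁ q₂ : ℕ}

namespace TransferMatrix

/-- Real polynomials in `z⁻¹` as complex power series. -/
noncomputable def ofPoly : Polynomial ℝ →+* ℂ⟦X⟧ :=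
  (Polynomial.coeToPowerSeries.ringHom (R := ℂ)).comp (Polynomial.mapRingHom Complex.ofRealHom)

theorem ofPoly_apply (a : Polynomial ℝ) :
    ofPoly a = ((a.map Complex.ofRealHom : Polynomial ℂ) : ℂ⟦X⟧) := rfl

theorem coeff_ofPoly (a : Polynomial ℝ) (i : ℕ) :
    PowerSeries.coeff i (ofPoly a) = (a.coeff i : ℂ) := by
  simp [ofPoly_apply]

theorem ofPoly_X : ofPoly Polynomial.X = PowerSeries.X := by
  simp [ofPoly_apply]

theorem ofPoly_C (x : ℝ) : ofPoly (Polynomial.C x) = PowerSeries.C (x : ℂ) := by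
  simp [ofPoly_apply]

theorem ofPoly_eq_map (a : Polynomial ℝ) :
    ofPoly a = PowerSeries.map Complex.ofRealHom (a : ℝ⟦X⟧) := by
  ext i; simp [coeff_ofPoly]

/-- The ring of proper real rational functions of `z`. -/
noncomputable def properRational : Subring ℂ⟦X⟧ where
  carrier := {g | ∃ a b : Polynomial ℝ, b.coeff 0 ≠ 0 ∧ ofPoly b * g = ofPoly a}
  mul_mem' := by
    rintro g h ⟨a, b, hb, hg⟩ ⟨c, d, hd, hh⟩
    refine ⟨a * c, b * d, by simp [Polynomial.mul_coeff_zero, hb, hd], ?_⟩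
    rw [map_mul, map_mul, ← hg, ← hh]; ring
  one_mem' := ⟨1, 1, by simp, by simp⟩
  add_mem' := by
    rintro g h ⟨a, b, hb, hg⟩ ⟨c, d, hd, hh⟩
    refine ⟨a * d + c * b, b * d, by simp [Polynomial.mul_coeff_zero, hb, hd], ?_⟩
    rw [map_mul, map_add, map_mul, map_mul, ← hg, ← hh]; ring
  zero_mem' := ⟨0, 1, by simp, by simp⟩
  neg_mem' := by
    rintro g ⟨a, b, hb, hg⟩
    exact ⟨-a, b, hb, by rw [map_neg, ← hg]; ring⟩

theorem ofPoly_mem (a : Polynomial ℝ) : ofPoly a ∈ properRational := ⟨a, 1, by simp, by simp⟩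

theorem inv_mem_properRational {g : ℂ⟦X⟧} (hg : g ∈ properRational)
    (h0 : PowerSeries.constantCoeff g ≠ 0) : g⁻¹ ∈ properRational := by
  obtain ⟨a, b, hb, h⟩ := hg
  refine ⟨b, a, fun ha => ?_, ?_⟩
  · have := congrArg (PowerSeries.coeff 0) h
    rw [coeff_ofPoly, ha, PowerSeries.coeff_zero_eq_constantCoeff_apply, map_mul,
      ← PowerSeries.coeff_zero_eq_constantCoeff_apply (ofPoly b), coeff_ofPoly] at this
    simp [hb, h0] at this
  · rw [← h, mul_assoc, PowerSeries.mul_inv_cancel _ h0, mul_one]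

/-- The denominator has nonzero constant term, hence is already invertible over ℝ⟦X⟧. -/
theorem exists_map_of_mem_properRational {g : ℂ⟦X⟧} (hg : g ∈ properRational) :
    ∃ g' : ℝ⟦X⟧, g = PowerSeries.map Complex.ofRealHom g' := by
  obtain ⟨a, b, hb, h⟩ := hg
  have hb' : (b : ℝ⟦X⟧)⁻¹ * (b : ℝ⟦X⟧) = 1 :=
    PowerSeries.inv_mul_cancel _ (by simpa using hb)
  refine ⟨(b : ℝ⟦X⟧)⁻¹ * a, ?_⟩
  rw [map_mul, ← ofPoly_eq_map a, ← h, ← mul_assoc, ofPoly_eq_map, ← map_mul, hb', map_one, one_mul]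

/-- Delete the coefficients of index less than `k` and divide by `z⁻ᵏ`. -/
noncomputable def tail (k : ℕ) (g : ℂ⟦X⟧) : ℂ⟦X⟧ :=
  PowerSeries.mk fun i => PowerSeries.coeff (i + k) g

theorem tail_mem_properRational (k : ℕ) {g : ℂ⟦X⟧} (hg : g ∈ properRational) :
    tail k g ∈ properRational := by
  obtain ⟨g', hg'⟩ := exists_map_of_mem_properRational hg
  obtain ⟨a, b, hb, h⟩ := hg
  have h1 : g = ofPoly (PowerSeries.trunc k g') + PowerSeries.X ^ k * tail k g := by
    ext i
    rw [map_add, coeff_ofPoly, PowerSeries.coeff_trunc, PowerSeries.coeff_X_pow_mul', hg']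
    by_cases hi : i < k
    · simp [hi]
    · simp [tail, hi, not_lt.mp hi]
  have h2 : PowerSeries.X ^ k * (ofPoly b * tail k g) =
      ofPoly (a - b * PowerSeries.trunc k g') := by
    rw [map_sub, map_mul, ← h]
    conv_rhs => rw [h1]
    ring
  -- Subtracting the truncation keeps the denominator `b`. The new numerator is zᐨᵏ times a power
  -- series, so its coefficients below k vanish and zᐨᵏ cancels.
  obtain ⟨c, hc⟩ : Polynomial.X ^ k ∣ a - b * PowerSeries.trunc k g' := by
    rw [Polynomial.X_pow_dvd_iff]
    intro d hd
    have := congrArg (PowerSeries.coeff d) h2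
    rw [coeff_ofPoly, PowerSeries.coeff_X_pow_mul', if_neg (by omega)] at this
    exact_mod_cast this.symm
  refine ⟨c, b, hb, ?_⟩
  rw [hc, map_mul, map_pow, ofPoly_X] at h2
  exact mul_left_cancel₀ (pow_ne_zero k PowerSeries.X_ne_zero) h2

theorem projShift_eq_smul (k : ℕ) (G : TransferMatrix p q) :
    projShift k G = (PowerSeries.X ^ k : ℂ⟦X⟧) • G.map (tail k) := by
  refine ext_coef fun i => ?_
  rw [coef_projShift, coef_X_pow_smul]
  by_cases h : k ≤ i
  · ext; simp [h, coef, tail]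
  · simp [h]

theorem IsProperRational.mul {G : TransferMatrix p q} {H : TransferMatrix q r}
    (hG : IsProperRational G) (hH : IsProperRational H) : IsProperRational (G * H) :=
  fun i j => properRational.sum_mem fun k _ => properRational.mul_mem (hG i k) (hH k j)

theorem IsProperRational.add {G H : TransferMatrix p q}
    (hG : IsProperRational G) (hH : IsProperRational H) : IsProperRational (G + H) :=
  fun i j => properRational.add_mem (hG i j) (hH i j)

theorem IsProperRational.neg {G : TransferMatrix p q}
    (hG : IsProperRational G) : IsProperRational (-G) :=
  fun i j => properRational.neg_mem (hG i j)

theorem IsProperRational.transpose {G : TransferMatrix p q}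
    (hG : IsProperRational G) : IsProperRational Gᵀ :=
  fun i j => hG j i

theorem IsProperRational.map_tail {G : TransferMatrix p q}
    (hG : IsProperRational G) (k : ℕ) : IsProperRational (G.map (tail k)) :=
  fun i j => tail_mem_properRational k (hG i j)

theorem isProperRational_const (M : Matrix (Fin p) (Fin q) ℝ) : IsProperRational (const M) :=
  fun i j => by
    have := ofPoly_mem (Polynomial.C (M i j))
    rwa [ofPoly_C] at this

/-- Cramer's rule for I - z⁻¹A: adjugate and determinant stay in the subring, and the determinant
has constant term 1, hence its inverse stays there too. -/
theorem isProperRational_resolv (A : Matrix (Fin n) (Fin n) ℝ) : IsProperRational (resolv A) := by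
  set M : TransferMatrix n n := 1 - (PowerSeries.X : ℂ⟦X⟧) • const A with hM
  have hX : PowerSeries.X ∈ properRational := ofPoly_X ▸ ofPoly_mem Polynomial.X
  have hMS : ∀ i j, M i j ∈ properRational := fun i j => by
    refine properRational.sub_mem ?_ (properRational.mul_mem hX (isProperRational_const A i j))
    rw [Matrix.one_apply]
    split_ifs
    exacts [properRational.one_mem, properRational.zero_mem]
  set M₀ : Matrix (Fin n) (Fin n) properRational := fun i j => ⟨M i j, hMS i j⟩ with hM₀
  have hmap : properRational.subtype.mapMatrix M₀ = M := rfl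
  have hdet : M.det ∈ properRational := by
    rw [← hmap, ← RingHom.map_det]
    exact M₀.det.2
  have hadj : ∀ i j, M.adjugate i j ∈ properRational := fun i j => by
    rw [← hmap, ← RingHom.map_adjugate]
    exact (M₀.adjugate i j).2
  have hdet0 : PowerSeries.constantCoeff M.det ≠ 0 := by
    have : (PowerSeries.constantCoeff (R := ℂ)).mapMatrix M = 1 := by
      ext i j
      by_cases h : i = j <;> simp [hM, h, Matrix.one_apply]
    rw [RingHom.map_det, this]
    simp
  have h := congrArg (M.adjugate * ·) (sub_mul_resolv A)
  simp only [← hM, ← Matrix.mul_assoc, adjugate_mul] at h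
  intro i j
  have hij : M.det * resolv A i j = PowerSeries.X * M.adjugate i j := by
    simpa using congrFun (congrFun h i) j
  have : resolv A i j = M.det⁻¹ * (PowerSeries.X * M.adjugate i j) := by
    rw [← hij, ← mul_assoc, PowerSeries.inv_mul_cancel _ hdet0, one_mul]
  show resolv A i j ∈ properRational
  rw [this]
  exact properRational.mul_mem (inv_mem_properRational hdet hdet0)
    (properRational.mul_mem hX (hadj i j))

theorem isProperRational_realization (A : Matrix (Fin n) (Fin n) ℝ)
    (B : Matrix (Fin n) (Fin q) ℝ) (C : Matrix (Fin p) (Fin n) ℝ)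
    (D : Matrix (Fin p) (Fin q) ℝ) : IsProperRational (realization A B C D) := by
  rw [realization_factor]
  exact (((isProperRational_const C).mul (isProperRational_resolv A)).mul
    (isProperRational_const B)).add (isProperRational_const D)

theorem isProperRational_of_mem_realFIR {N : ℕ} {V : TransferMatrix p q} (hV : V ∈ RealFIR N) :
    IsProperRational V := by
  intro i j
  have h : V i j = ofPoly (PowerSeries.trunc (N + 1)
      (PowerSeries.mk fun k => (coef V k i j).re)) := by
    ext k
    rw [coeff_ofPoly, PowerSeries.coeff_trunc]
    split_ifs with hk
    · rw [PowerSeries.coeff_mk]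
      exact Complex.ext rfl (hV.2 k i j)
    · have := congrFun (congrFun (hV.1 k (Or.inr (by omega))) i) j
      simpa [coef] using this
  show V i j ∈ properRational
  rw [h]
  exact ofPoly_mem _

theorem IsProperRational.exists_coef_eq_toC {G : TransferMatrix p q} (hG : IsProperRational G)
    (i : ℕ) : ∃ M : Matrix (Fin p) (Fin q) ℝ, coef G i = toC M := by
  choose g hg using fun a b => exists_map_of_mem_properRational (hG a b)
  refine ⟨Matrix.of fun a b => PowerSeries.coeff i (g a b), ?_⟩
  ext a b
  simp [coef, toC, hg a b]

theorem im_h2Inner_eq_zero {G H : TransferMatrix p q} (hG : IsProperRational G)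
    (hH : IsProperRational H) (N : ℕ) : (h2Inner (projFIR N G) H).im = 0 := by
  have h : ∀ i, (coef (projFIR N G) i * (coef H i)ᴴ).trace =
      (((coef (projFIR N G) i * (coef H i)ᴴ).trace.re : ℝ) : ℂ) := fun i => by
    obtain ⟨M, hM⟩ := hG.exists_coef_eq_toC i
    obtain ⟨M', hM'⟩ := hH.exists_coef_eq_toC i
    rw [coef_projFIR]
    split_ifs
    · rw [hM, hM', ← toC_transpose, ← toC_mul]
      simp [Matrix.trace, toC]
    · simp
  rw [h2Inner, tsum_congr h, ← Complex.ofReal_tsum, Complex.ofReal_im]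

end TransferMatrix

namespace Plant.Regular

variable {P : Plant n p₁ p₂ q₁ q₂} {X Y : Matrix (Fin n) (Fin n) ℝ}

theorem isProperRational_weighted (h : P.Regular X Y) {V : TransferMatrix p₂ q₂}
    (hV : IsProperRational V) : IsProperRational (P.weighted X Y V) := by
  rw [h.weighted_eq]
  exact (((isProperRational_const _).mul (isProperRational_realization _ _ _ _)).mul hV).mul
    ((isProperRational_const _).mul (isProperRational_realization _ _ _ _)).transpose

end Plant.Regular

theorem Plant.isProperRational_T (P : Plant n p₁ p₂ q₁ q₂) (X Y : Matrix (Fin n) (Fin n) ℝ) :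
    IsProperRational (P.T X Y) :=
  ((isProperRational_const _).mul (isProperRational_realization _ _ _ _)).mul
    (isProperRational_const _)

end ModelMatching

/-! ### The FIR least squares problem and optimality. -/

namespace ModelMatching

open TransferMatrix Matrix

variable {n p q r p₁ p₂ q₁ q₂ : ℕ}

/-- `f v` is the orthogonal projection of -t on the range of `f`; injectivity makes the Pythagorean
excess ‖f (w - v)‖² positive. -/
theorem exists_norm_add_lt {V E : Type*} [AddCommGroup V] [Module ℝ V] [NormedAddCommGroup E]
    [InnerProductSpace ℝ E] [FiniteDimensional ℝ E] (f : V →ₗ[ℝ] E) (hf : Function.Injective f)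
    (t : E) : ∃ v, ∀ w, w ≠ v → ‖f v + t‖ ^ 2 < ‖f w + t‖ ^ 2 := by
  obtain ⟨v, hv⟩ := (LinearMap.range f).starProjection_apply_mem (-t)
  refine ⟨v, fun w hw => ?_⟩
  have h0 : inner ℝ (f v + t) (f (w - v)) = 0 := by
    have := (LinearMap.range f).starProjection_inner_eq_zero (-t) (f (w - v)) ⟨_, rfl⟩
    rw [← hv] at this
    have e : f v + t = -(-t - f v) := by abel
    rw [e, inner_neg_left, this, neg_zero]
  have e : f w + t = (f v + t) + f (w - v) := by rw [map_sub]; abel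
  have hpos : 0 < ‖f (w - v)‖ := norm_pos_iff.mpr fun h =>
    hw (sub_eq_zero.mp (hf (h.trans (map_zero f).symm)))
  rw [e, norm_add_sq_real (f v + t), h0]
  nlinarith

namespace TransferMatrix

theorem frobSq_add (M M' : Matrix (Fin p) (Fin q) ℂ) :
    frobSq (M + M') = frobSq M + 2 * (M * M'ᴴ).trace.re + frobSq M' := by
  have h : (M' * Mᴴ).trace.re = (M * M'ᴴ).trace.re := by
    have : (M' * Mᴴ).trace = star (M * M'ᴴ).trace := by
      rw [← trace_conjTranspose, conjTranspose_mul, conjTranspose_conjTranspose]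
    rw [this]; simp
  have h1 := congrArg Complex.re (trace_mul_conjTranspose (M + M'))
  rw [conjTranspose_add, Matrix.add_mul, Matrix.mul_add, Matrix.mul_add] at h1
  simp only [trace_add, Complex.add_re, trace_mul_conjTranspose, Complex.ofReal_re, h] at h1
  linarith

theorem normSq_projFIR (N : ℕ) (G : TransferMatrix p q) :
    normSq (projFIR N G) = ∑ i ∈ Finset.Icc 1 N, frobSq (coef G i) := by
  rw [normSq, tsum_eq_sum (s := Finset.Icc 1 N)]
  · refine Finset.sum_congr rfl fun i hi => ?_
    rw [coef_projFIR, if_pos (Finset.mem_Icc.mp hi)]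
  · intro i hi
    rw [coef_projFIR, if_neg (by simpa using hi), frobSq_zero]

theorem h2Inner_projFIR (N : ℕ) (G H : TransferMatrix p q) :
    h2Inner (projFIR N G) H = ∑ i ∈ Finset.Icc 1 N, (coef G i * (coef H i)ᴴ).trace := by
  rw [h2Inner, tsum_eq_sum (s := Finset.Icc 1 N)]
  · refine Finset.sum_congr rfl fun i hi => ?_
    rw [coef_projFIR, if_pos (Finset.mem_Icc.mp hi)]
  · intro i hi
    rw [coef_projFIR, if_neg (by simpa using hi)]
    simp

theorem sub_projShift_eq_projFIR {G : TransferMatrix p q} (hG : coef G 0 = 0) (N : ℕ) :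
    G - projShift (N + 1) G = projFIR N G := by
  refine ext_coef fun i => ?_
  rw [coef_sub, coef_projShift, coef_projFIR]
  rcases Nat.eq_zero_or_pos i with rfl | hi
  · simp [hG]
  · by_cases h : i ≤ N
    · rw [if_neg (by omega), if_pos ⟨hi, h⟩, sub_zero]
    · rw [if_pos (by omega), if_neg (by omega), sub_self]

theorem coef_smul (c : ℝ) (G : TransferMatrix p q) (i : ℕ) : coef (c • G) i = c • coef G i := by
  ext a b
  simp [coef]

theorem shiftH2_anti {k l : ℕ} (h : k ≤ l) :
    (shiftH2 l : Set (TransferMatrix p q)) ⊆ shiftH2 k :=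
  fun _ hG => ⟨hG.1, fun i hi => hG.2 i (by omega)⟩

theorem mem_shiftH2_of_mem_realFIR {N : ℕ} {V : TransferMatrix p q} (hV : V ∈ RealFIR N) :
    V ∈ (shiftH2 1 : Set (TransferMatrix p q)) := by
  refine ⟨inH2_iff_frobSq.mpr (summable_of_ne_finset_zero (s := Finset.Icc 1 N) fun i hi => ?_),
    fun i hi => hV.1 i (Or.inl hi)⟩
  rw [Finset.mem_Icc] at hi
  rw [hV.1 i (by omega), frobSq_zero]

theorem projShift_add (k : ℕ) (G H : TransferMatrix p q) :
    projShift k (G + H) = projShift k G + projShift k H := by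
  refine ext_coef fun i => ?_
  simp only [coef_add, coef_projShift]
  split_ifs <;> simp

theorem projShift_sub_self (k : ℕ) (G : TransferMatrix p q) :
    projShift k (G - projShift k G) = 0 := by
  refine ext_coef fun i => ?_
  simp only [coef_sub, coef_projShift, coef_zero]
  split_ifs <;> simp

end TransferMatrix

theorem IsUniqueMinimizer.h2Norm {α : Type*} {f : α → TransferMatrix p q} {s : Set α} {x : α}
    (hx : IsUniqueMinimizer (fun y => normSq (f y)) s x) :
    IsUniqueMinimizer (fun y => h2Norm (f y)) s x := by
  refine ⟨hx.1, fun y hy hne => ?_⟩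
  simp only [h2Norm_eq]
  exact Real.sqrt_lt_sqrt (normSq_nonneg _) (hx.2 y hy hne)

namespace Plant

variable {P : Plant n p₁ p₂ q₁ q₂} {X Y : Matrix (Fin n) (Fin n) ℝ}

theorem coef_T_zero (P : Plant n p₁ p₂ q₁ q₂) (X Y : Matrix (Fin n) (Fin n) ℝ) :
    coef (P.T X Y) 0 = 0 := by
  have h : ∀ i < 1, coef (realization P.A (P.L Y) (P.K X) 0) i = 0 := fun i hi => by
    obtain rfl : i = 0 := by omega
    ext; simp [coef, realization]
  exact coef_mul_eq_zero_left (coef_mul_eq_zero_right h _) _ 0 one_pos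

/-- Completing the square: up to a constant independent of `V`, the cost is a squared distance in 𝒳.
-/
theorem firCost_eq (P : Plant n p₁ p₂ q₁ q₂) (X Y : Matrix (Fin n) (Fin n) ℝ) (N : ℕ)
    (V : TransferMatrix p₂ q₂) :
    P.firCost X Y N V = normSq (projFIR N (P.weighted X Y V + P.T X Y)) -
      normSq (projFIR N (P.T X Y)) := by
  rw [firCost, h2Norm_sq, normSq_projFIR, normSq_projFIR, normSq_projFIR, h2Inner_projFIR,
    Complex.re_sum, Finset.mul_sum, ← Finset.sum_add_distrib, ← Finset.sum_sub_distrib]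
  refine Finset.sum_congr rfl fun i _ => ?_
  rw [coef_add, frobSq_add]
  ring

theorem U_eq (P : Plant n p₁ p₂ q₁ q₂) (X Y : Matrix (Fin n) (Fin n) ℝ) (N : ℕ)
    (V : TransferMatrix p₂ q₂) : P.U X Y N V =
      -(P.WL X * projShift (N + 1) (P.weighted X Y V + P.T X Y) * P.WR Y) := by
  rw [U, QN, projShift_add]
  simp only [Matrix.mul_add, Matrix.add_mul]
  abel

theorem weighted_neg (P : Plant n p₁ p₂ q₁ q₂) (X Y : Matrix (Fin n) (Fin n) ℝ)
    (V : TransferMatrix p₂ q₂) : P.weighted X Y (-V) = -P.weighted X Y V := by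
  simp only [weighted, Matrix.mul_neg, Matrix.neg_mul]

theorem weighted_zero (P : Plant n p₁ p₂ q₁ q₂) (X Y : Matrix (Fin n) (Fin n) ℝ) :
    P.weighted X Y 0 = 0 := by
  simp [weighted]

/-- The coefficients `1, …, N` of `W_L⁻¹ V W_R⁻¹` as a vector. -/
noncomputable def weightedCoefs (P : Plant n p₁ p₂ q₁ q₂) (X Y : Matrix (Fin n) (Fin n) ℝ)
    (N : ℕ) : TransferMatrix p₂ q₂ →ₗ[ℝ]
      PiLp 2 (fun _ : Finset.Icc 1 N × Fin p₂ × Fin q₂ => ℂ) where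
  toFun V := WithLp.toLp 2 fun x => coef (P.weighted X Y V) x.1 x.2.1 x.2.2
  map_add' V W := by
    ext x; simp [weighted_add, coef_add]
  map_smul' c V := by
    have : P.weighted X Y (c • V) = c • P.weighted X Y V := by
      simp only [weighted, Matrix.mul_smul, Matrix.smul_mul]
    ext x; simp [this, coef_smul]

theorem norm_sq_toLp_coef (G : TransferMatrix p q) (N : ℕ) :
    ‖(WithLp.toLp 2 fun x => coef G x.1 x.2.1 x.2.2 :
      PiLp 2 (fun _ : Finset.Icc 1 N × Fin p × Fin q => ℂ))‖ ^ 2 = normSq (projFIR N G) := by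
  rw [PiLp.norm_sq_eq_of_L2, normSq_projFIR, Fintype.sum_prod_type,
    ← Finset.sum_coe_sort (Finset.Icc 1 N)]
  refine Finset.sum_congr rfl fun i _ => ?_
  rw [Fintype.sum_prod_type]
  rfl

namespace Regular

variable (h : P.Regular X Y)
include h

theorem eq_of_weighted_eq {V W : TransferMatrix p₂ q₂}
    (hVW : P.weighted X Y V = P.weighted X Y W) : V = W := by
  rw [← h.WL_mul_weighted_mul_WR V, hVW, h.WL_mul_weighted_mul_WR]

theorem U_mem_shiftH2 {V : TransferMatrix p₂ q₂} (hV : InH2 V) (N : ℕ) :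
    P.U X Y N V ∈ (shiftH2 (N + 1) : Set (TransferMatrix p₂ q₂)) := by
  have hG := (h.inH2_weighted hV).add h.inH2_T
  have hS := (projShift_isOrthogonalProjection (N + 1) _ hG).1
  rw [U_eq]
  refine ⟨((h.control.stable_WL.mul_inH2 hS.1).mul_stable h.stable_WR).neg, fun i hi => ?_⟩
  rw [coef_neg, coef_mul_eq_zero_left (coef_mul_eq_zero_right hS.2 _) _ i hi, neg_zero]

/-- Adding `U V` removes exactly the tail of W_L⁻¹ V W_R⁻¹ + T. -/
theorem weighted_U_add (V : TransferMatrix p₂ q₂) (N : ℕ) :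
    P.weighted X Y (P.U X Y N V + V) + P.T X Y = P.weighted X Y V + P.T X Y -
      projShift (N + 1) (P.weighted X Y V + P.T X Y) := by
  rw [weighted_add, U_eq, weighted_neg, h.weighted_WL_mul_WR]
  abel

/-- Causality: `weighted` multiplies by power series in z⁻¹, so Q - V of order N + 1 stays of order
N + 1. -/
theorem sub_projShift_congr {V Q : TransferMatrix p₂ q₂} {N : ℕ}
    (hVQ : ∀ i < N + 1, coef Q i = coef V i) :
    P.weighted X Y Q + P.T X Y - projShift (N + 1) (P.weighted X Y Q + P.T X Y) =
      P.weighted X Y V + P.T X Y - projShift (N + 1) (P.weighted X Y V + P.T X Y) := by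
  have hW := h.coef_weighted (V := Q - V) (k := N + 1) fun i hi => by
    rw [coef_sub, hVQ i hi, sub_self]
  have e : P.weighted X Y Q = P.weighted X Y (Q - V) + P.weighted X Y V := by
    rw [← weighted_add, sub_add_cancel]
  refine ext_coef fun i => ?_
  simp only [coef_sub, coef_projShift]
  split_ifs with hi
  · simp
  · rw [e, coef_add, coef_add, hW i (by omega), zero_add, coef_add]

/-- Decouples the cost: the first norm sees only the FIR part, the second is the tail, which `U V`
makes zero. The constant serves all `V` and `N`, so different FIR parts can be compared. -/
theorem exists_cost : ∃ c : ℝ, ∀ V : TransferMatrix p₂ q₂, ∀ N : ℕ,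
    ∀ Q ∈ (shiftH2 1 : Set (TransferMatrix p₂ q₂)), (∀ i < N + 1, coef Q i = coef V i) →
      normSq (P.closedLoop Q) = c +
        normSq (P.weighted X Y V + P.T X Y - projShift (N + 1) (P.weighted X Y V + P.T X Y)) +
        normSq (projShift (N + 1) (P.weighted X Y Q + P.T X Y)) := by
  obtain ⟨c, hc⟩ := h.exists_normSq_closedLoop
  refine ⟨c, fun V N Q hQ hVQ => ?_⟩
  rw [hc Q hQ, normSq_eq_add_projShift ((h.inH2_weighted hQ.1).add h.inH2_T) (N + 1),
    h.sub_projShift_congr hVQ, add_assoc]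

theorem coef_U_add {V : TransferMatrix p₂ q₂} (hV : InH2 V) (N : ℕ) :
    ∀ i < N + 1, coef (P.U X Y N V + V) i = coef V i := fun i hi => by
  rw [coef_add, (h.U_mem_shiftH2 hV N).2 i hi, zero_add]

theorem U_add_mem_shiftH2 {V : TransferMatrix p₂ q₂}
    (hV : V ∈ (shiftH2 1 : Set (TransferMatrix p₂ q₂))) (N : ℕ) :
    P.U X Y N V + V ∈ (shiftH2 1 : Set (TransferMatrix p₂ q₂)) :=
  ⟨(h.U_mem_shiftH2 hV.1 N).1.add hV.1, fun i hi => by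
    rw [h.coef_U_add hV.1 N i (by omega), hV.2 i hi]⟩

/-- With the FIR part fixed only the tail term varies. If it vanishes, `Q` and U(V) + V have equal
weighted forms, hence coincide. -/
theorem normSq_closedLoop_lt {V Q : TransferMatrix p₂ q₂} {N : ℕ}
    (hV : V ∈ (shiftH2 1 : Set (TransferMatrix p₂ q₂)))
    (hQ : Q ∈ (shiftH2 1 : Set (TransferMatrix p₂ q₂)))
    (hVQ : ∀ i < N + 1, coef Q i = coef V i) (hne : Q ≠ P.U X Y N V + V) :
    normSq (P.closedLoop (P.U X Y N V + V)) < normSq (P.closedLoop Q) := by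
  obtain ⟨c, hc⟩ := h.exists_cost
  rw [hc V N _ (h.U_add_mem_shiftH2 hV N) (h.coef_U_add hV.1 N), hc V N Q hQ hVQ,
    h.weighted_U_add, projShift_sub_self]
  have hz : normSq (0 : TransferMatrix p₂ q₂) = 0 := by simp [normSq, coef_zero, frobSq_zero]
  rw [hz, add_zero]
  refine lt_add_of_pos_right _ ((normSq_nonneg _).lt_of_ne' fun h0 => hne ?_)
  have h1 := normSq_eq_zero (((h.inH2_weighted hQ.1).add h.inH2_T).projShift _) h0
  have h2 := h.sub_projShift_congr hVQ
  rw [h1, sub_zero, ← h.weighted_U_add] at h2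
  exact h.eq_of_weighted_eq (add_right_cancel h2)

theorem isUniqueMinimizer_QN (N : ℕ) :
    IsUniqueMinimizer (fun Q => h2Norm (P.closedLoop Q)) (shiftH2 (N + 1)) (P.QN X Y N) := by
  have hU : P.QN X Y N = P.U X Y N 0 + 0 := by
    rw [add_zero, U_eq, weighted_zero, zero_add, QN]
  rw [hU]
  refine IsUniqueMinimizer.h2Norm ⟨?_, fun Q hQ hne => ?_⟩
  · rw [add_zero]
    exact h.U_mem_shiftH2 inH2_zero N
  · exact h.normSq_closedLoop_lt ⟨inH2_zero, fun i _ => coef_zero i⟩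
      (shiftH2_anti (by omega) hQ) (fun i hi => by rw [hQ.2 i hi, coef_zero]) hne

theorem exists_isUniqueMinimizer_firCost {N : ℕ} {𝒴 : Submodule ℝ (TransferMatrix p₂ q₂)}
    (h𝒴 : (𝒴 : Set (TransferMatrix p₂ q₂)) ⊆ RealFIR N) :
    ∃ V, IsUniqueMinimizer (P.firCost X Y N) 𝒴 V := by
  set f := (P.weightedCoefs X Y N).comp 𝒴.subtype with hf
  have hinj : Function.Injective f := by
    rw [injective_iff_map_eq_zero]
    intro V hV
    have hV1 := mem_shiftH2_of_mem_realFIR (h𝒴 V.2)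
    -- If the coefficients 0, …, N of W_L⁻¹ V W_R⁻¹ vanish, causality of W_L and W_R makes those of
    -- `V` vanish, and `V` has no others.
    have hw : ∀ i < N + 1, coef (P.weighted X Y V) i = 0 := fun i hi => by
      rcases Nat.eq_zero_or_pos i with rfl | hi0
      · exact h.coef_weighted hV1.2 0 one_pos
      · ext a b
        have := congrFun (congrArg WithLp.ofLp hV)
          (⟨i, Finset.mem_Icc.mpr ⟨hi0, by omega⟩⟩, a, b)
        exact this
    have hV0 := coef_mul_eq_zero_left (coef_mul_eq_zero_right hw (P.WL X)) (P.WR Y)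
    rw [h.WL_mul_weighted_mul_WR] at hV0
    refine Subtype.ext (ext_coef fun i => ?_)
    by_cases hi : i < N + 1
    · rw [hV0 i hi]; exact (coef_zero i).symm
    · rw [(h𝒴 V.2).1 i (by omega)]; exact (coef_zero i).symm
  obtain ⟨V, hV⟩ := exists_norm_add_lt f hinj
    (WithLp.toLp 2 fun x => coef (P.T X Y) x.1 x.2.1 x.2.2)
  have hnorm : ∀ W : 𝒴, ‖f W + WithLp.toLp 2 fun x => coef (P.T X Y) x.1 x.2.1 x.2.2‖ ^ 2 =
      normSq (projFIR N (P.weighted X Y W + P.T X Y)) := fun W => by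
    rw [← norm_sq_toLp_coef]
    congr 2
  refine ⟨V, V.2, fun W hW hne => ?_⟩
  have hlt := hV ⟨W, hW⟩ fun e => hne (congrArg Subtype.val e)
  rw [hnorm, hnorm] at hlt
  rw [firCost_eq, firCost_eq]
  exact sub_lt_sub_right hlt _

theorem U_add_mem_constraintSpace {N : ℕ} {𝒴 : Submodule ℝ (TransferMatrix p₂ q₂)}
    (h𝒴 : (𝒴 : Set (TransferMatrix p₂ q₂)) ⊆ RealFIR N) {V : TransferMatrix p₂ q₂}
    (hV : V ∈ 𝒴) : P.U X Y N V + V ∈ constraintSpace N 𝒴 := by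
  have hG := (h.isProperRational_weighted
    (isProperRational_of_mem_realFIR (h𝒴 hV))).add (P.isProperRational_T X Y)
  refine ⟨V, hV, -(P.WL X * (P.weighted X Y V + P.T X Y).map (tail (N + 1)) * P.WR Y), ?_, ?_⟩
  · exact ((((isProperRational_realization _ _ _ _).mul (isProperRational_const _)).mul
      (hG.map_tail _)).mul ((isProperRational_const _).mul
        (isProperRational_realization _ _ _ _))).neg
  · rw [U_eq, projShift_eq_smul, Matrix.mul_smul, Matrix.smul_mul, smul_neg, add_comm]

theorem isUniqueMinimizer_U_add {N : ℕ} {𝒴 : Submodule ℝ (TransferMatrix p₂ q₂)}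
    (h𝒴 : (𝒴 : Set (TransferMatrix p₂ q₂)) ⊆ RealFIR N) {V : TransferMatrix p₂ q₂}
    (hV : IsUniqueMinimizer (P.firCost X Y N) 𝒴 V) :
    IsUniqueMinimizer (fun Q => h2Norm (P.closedLoop Q))
      (constraintSpace N 𝒴 ∩ shiftH2 1) (P.U X Y N V + V) := by
  have hV1 := mem_shiftH2_of_mem_realFIR (h𝒴 hV.1)
  refine IsUniqueMinimizer.h2Norm ⟨⟨h.U_add_mem_constraintSpace h𝒴 hV.1,
    h.U_add_mem_shiftH2 hV1 N⟩, ?_⟩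
  rintro Q ⟨⟨W, hW, R, -, hQR⟩, hQ⟩ hne
  have hWQ : ∀ i < N + 1, coef Q i = coef W i := fun i hi => by
    rw [hQR, coef_add, coef_X_pow_smul, if_neg (by omega), add_zero]
  by_cases hVW : W = V
  · exact h.normSq_closedLoop_lt hV1 hQ (hVW ▸ hWQ) hne
  · obtain ⟨c, hc⟩ := h.exists_cost
    have hlt := hV.2 W hW hVW
    -- Strict properness makes the part below index N + 1 agree with the projection onto 𝒳, which
    -- omits index 0.
    have h0 : ∀ Z ∈ 𝒴, coef (P.weighted X Y Z + P.T X Y) 0 = 0 := fun Z hZ => by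
      rw [coef_add, h.coef_weighted (mem_shiftH2_of_mem_realFIR (h𝒴 hZ)).2 0 one_pos,
        coef_T_zero, add_zero]
    have hz : normSq (0 : TransferMatrix p₂ q₂) = 0 := by simp [normSq, coef_zero, frobSq_zero]
    rw [firCost_eq, firCost_eq, ← sub_projShift_eq_projFIR (h0 V hV.1),
      ← sub_projShift_eq_projFIR (h0 W hW)] at hlt
    simp only
    rw [hc V N _ (h.U_add_mem_shiftH2 hV1 N) (h.coef_U_add hV1.1 N), hc W N Q hQ hWQ,
      h.weighted_U_add, projShift_sub_self, hz]
    have := normSq_nonneg (projShift (N + 1) (P.weighted X Y Q + P.T X Y))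
    linarith

end Regular

end Plant

end ModelMatching

open ModelMatching ModelMatching.TransferMatrix in
theorem mainTheorem1 {n p₁ p₂ q₁ q₂ : ℕ} (P : Plant n p₁ p₂ q₁ q₂)
    (hA : SchurStable P.A)
    (hD₁₂ : (P.D₁₂.transpose * P.D₁₂).PosDef)
    (hD₂₁ : (P.D₂₁ * P.D₂₁.transpose).PosDef)
    (X Y : Matrix (Fin n) (Fin n) ℝ)
    (hX : P.IsStabilizingControl X) (hY : P.IsStabilizingEstimation Y)
    (N : ℕ) (hN : 1 ≤ N)
    (𝒴 : Submodule ℝ (TransferMatrix p₂ q₂))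
    (h𝒴 : (𝒴 : Set (TransferMatrix p₂ q₂)) ⊆ RealFIR N) :
    -- the norms, projections and inner products below are taken of elements of `H₂`
    (∀ Q ∈ shiftH2 1, InH2 (P.closedLoop Q)) ∧
    InH2 (P.T X Y) ∧
    (∀ V ∈ 𝒴, InH2 (P.weighted X Y V) ∧ (h2Inner (projFIR N (P.weighted X Y V)) (P.T X Y)).im = 0) ∧
    -- `Q_N` is the optimal centralized delayed controller
    IsUniqueMinimizer (fun Q => h2Norm (P.closedLoop Q)) (shiftH2 (N + 1)) (P.QN X Y N) ∧
    -- the optimal solution of the decentralized problem is `U(V) + V`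
    ∃ V, IsUniqueMinimizer (P.firCost X Y N) 𝒴 V ∧
      IsUniqueMinimizer (fun Q => h2Norm (P.closedLoop Q))
        (constraintSpace N 𝒴 ∩ shiftH2 1) (P.U X Y N V + V) := by
  have h : P.Regular X Y := ⟨hA, hD₁₂, hD₂₁, hX, hY⟩
  obtain ⟨V, hV⟩ := h.exists_isUniqueMinimizer_firCost h𝒴
  exact ⟨fun Q hQ => h.inH2_closedLoop hQ.1, h.inH2_T, fun V hV =>
    ⟨h.inH2_weighted (mem_shiftH2_of_mem_realFIR (h𝒴 hV)).1,
      im_h2Inner_eq_zero (h.isProperRational_weighted (isProperRational_of_mem_realFIR (h𝒴 hV)))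
        (P.isProperRational_T X Y) N⟩,
    h.isUniqueMinimizer_QN N, V, hV, h.isUniqueMinimizer_U_add h𝒴 hV⟩
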